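/- An \emph{arrangement of pseudocircles} is a finite family of simple closed curves on the sphere (or in the plane) such that any two of the curves have at most two points in common; it is \emph{simple} if no three of the curves have a common point. The \emph{vertices} of an arrangement are the intersection points of its curves, and its \emph{edges} are the pieces into which the vertices subdivide the curves; these form the \emph{arrangement graph}. The \emph{faces} (cells) are the connected components of the complement of the union of all curves; a face is a \emph{$k$-gon} (triangle for $k=3$, pentagon for $k=5$) if its boundary is a cycle of $k$ vertices and $k$ edges, and an edge is \emph{incident} to a face if it lies on the boundary of the face. The arrangement is \emph{$\triangle$-saturated} if every edge is incident to exactly one triangular face. Let $\mathcal{A}$ be a simple $\triangle$-saturated arrangement of pseudocircles with a pentagonal cell $P$. Let $p_0,\dots,p_4$ be the vertices of $P$ in cyclic order, let $T_j$ be the triangular face incident to the edge $p_jp_{j+1}$ of $P$ (indices modulo $5$), and let $q_j$ be the third vertex of $T_j$. A \emph{corona extension} $\mathcal{A}^+$ of $\mathcal{A}$ at $P$ is an arrangement of pseudocircles that consists of $\mathcal{A}$ and one additional pseudocircle $\gamma$, where $\gamma$ encloses $P$ (one side of $\gamma$ contains the closure of $P$ and no vertices of $\mathcal{A}$ other than $p_0,\dots,p_4$),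 intersects only pseudocircles that bound $P$, and meets these in exactly ten points: going once around $P$, it crosses one after the other, for $j=0,\dots,4$, the edges $p_jq_j$ and $p_{j+1}q_j$ of $T_j$, each once and in an interior point, running inside $T_j$ between these two crossings and inside a non-triangular face between the crossing with $p_{j+1}q_j$ and the crossing with $p_{j+1}q_{j+1}$. Then the arrangement graph of every corona extension $\mathcal{A}^+$ of $\mathcal{A}$ at $P$ has chromatic number exactly $4$. -/

import Mathlib

open Set

/-- The surfaces that carry the arrangements: the two-dimensional sphere and the plane. -/
def IsSphereOrPlane (X : Type*) [TopologicalSpace X] : Prop :=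
  Nonempty (X ≃ₜ Metric.sphere (0 : EuclideanSpace ℝ (Fin 3)) 1) ∨
    Nonempty (X ≃ₜ EuclideanSpace ℝ (Fin 2))

/-- The closed arc of the circle `ℝ / ℤ` that runs from `s` to `t` in the positive direction
(the whole circle if `s = t`). -/
def closedArc (s t : UnitAddCircle) : Set UnitAddCircle := {x | btw s x t}

/-- The open arc of the circle `ℝ / ℤ` that runs from `s` to `t` in the positive direction
(the circle without `s` if `s = t`). -/
def openArc (s t : UnitAddCircle) : Set UnitAddCircle := {x | btw s x t ∧ x ≠ s ∧ x ≠ t}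

/-- An arrangement of pseudocircles in `X`: a family of simple closed curves, given by
parametrizations over the circle `ℝ / ℤ`, any two of which have at most two common points. -/
structure PseudocircleArrangement (X : Type*) [TopologicalSpace X] (ι : Type*) where
  curve : ι → UnitAddCircle → X
  continuous_curve : ∀ i, Continuous (curve i)
  injective_curve : ∀ i, Function.Injective (curve i)
  inter_le_two : ∀ i j, i ≠ j → (range (curve i) ∩ range (curve j)).encard ≤ 2

namespace PseudocircleArrangement

variable {X : Type*} [TopologicalSpace X] {ι : Type*} (A : PseudocircleArrangement X ι)

/-- An arrangement is simple if no three of its pseudocircles have a common point. -/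
def IsSimple : Prop :=
  ∀ i j k, i ≠ j → j ≠ k → i ≠ k →
    range (A.curve i) ∩ range (A.curve j) ∩ range (A.curve k) = ∅

/-- The union of all pseudocircles. -/
def support : Set X := ⋃ i, range (A.curve i)

/-- The vertices of the arrangement: the intersection points of its pseudocircles. -/
def vertices : Set X := {x | ∃ i j, i ≠ j ∧ x ∈ range (A.curve i) ∩ range (A.curve j)}

/-- The edges of the arrangement: the pieces into which the vertices subdivide the
pseudocircles.  An edge is a piece of one pseudocircle that runs, in the direction of the
parametrization, from a vertex to the next vertex. -/
@[ext]
structure Edge where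
  idx : ι
  src : UnitAddCircle
  tgt : UnitAddCircle
  src_mem : A.curve idx src ∈ A.vertices
  tgt_mem : A.curve idx tgt ∈ A.vertices
  interior_notMem : ∀ x ∈ openArc src tgt, A.curve idx x ∉ A.vertices

variable {A} in
/-- The edge without its two endpoints, as a set of points. -/
def Edge.openCarrier (e : A.Edge) : Set X := A.curve e.idx '' openArc e.src e.tgt

variable {A} in
/-- The edge together with its two endpoints, as a set of points. -/
def Edge.closedCarrier (e : A.Edge) : Set X := A.curve e.idx '' closedArc e.src e.tgt

variable {A} in
/-- The (undirected) edge `e` has the endpoints `u` and `v`. -/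
def Edge.Joins (e : A.Edge) (u v : X) : Prop :=
  (A.curve e.idx e.src = u ∧ A.curve e.idx e.tgt = v) ∨
    (A.curve e.idx e.src = v ∧ A.curve e.idx e.tgt = u)

/-- The arrangement graph. -/
def graph : SimpleGraph A.vertices where
  Adj u v := u ≠ v ∧ ∃ e : A.Edge, e.Joins u v
  symm := ⟨fun _ _ h => ⟨h.1.symm, h.2.imp fun _ he => he.symm⟩⟩
  loopless := ⟨fun _ h => h.1 rfl⟩

/-- The faces (cells) of the arrangement: the connected components of the complement of the
union of all pseudocircles. -/
def IsFace (F : Set X) : Prop :=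
  ∃ x ∈ A.supportᶜ, F = connectedComponentIn A.supportᶜ x

/-- `F` is a face whose boundary is the cycle of length `k` with the vertices
`v 0, …, v (k - 1)` and the edges `e j` from `v j` to `v (j + 1)` (cyclically). -/
structure IsFaceWithBoundary (F : Set X) {k : ℕ} [NeZero k] (v : Fin k → X)
    (e : Fin k → A.Edge) : Prop where
  isFace : A.IsFace F
  injective_vertex : Function.Injective v
  injective_edge : Function.Injective e
  joins : ∀ j, (e j).Joins (v j) (v (j + 1))
  frontier_eq : frontier F = ⋃ j, (e j).closedCarrier

/-- `F` is a `k`-gonal face: its boundary is a cycle of length `k`. -/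
def IsPolygonalFace (k : ℕ) [NeZero k] (F : Set X) : Prop :=
  ∃ (v : Fin k → X) (e : Fin k → A.Edge), A.IsFaceWithBoundary F v e

/-- An arrangement is triangle-saturated if every edge is incident to exactly one triangular
face. -/
def IsTriangleSaturated : Prop :=
  ∀ e : A.Edge, ∃! F : Set X, A.IsPolygonalFace 3 F ∧ e.openCarrier ⊆ frontier F

/-- `B` is a corona extension of `A` at the pentagonal face `P`: it is `A` together with one
additional pseudocircle, which runs once around `P`, crossing one after the other the ten edges
that leave the boundary of `P`, and no others.

The boundary of `P` has the vertices `p j` and the edges `e j` from `p j` to `p (j + 1)`.  On the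
other side of `e j` lies the triangular face `T j`, with third vertex `q j` and with the edges
`a j` from `p j` to `q j` and `b j` from `p (j + 1)` to `q j`.  The new pseudocircle
crosses `a j` at the parameter `x j` and `b j` at the parameter `y j`. -/
structure IsCoronaExtension (A : PseudocircleArrangement X ι)
    (B : PseudocircleArrangement X (Option ι)) (P : Set X) : Prop where
  curve_some : ∀ i, B.curve (some i) = A.curve i
  exists_corona : ∃ (p q : Fin 5 → X) (e a b : Fin 5 → A.Edge) (T : Fin 5 → Set X)
      (x y : Fin 5 → UnitAddCircle),
    A.IsFaceWithBoundary P p e ∧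
    (∀ j, A.IsFaceWithBoundary (T j) ![p j, p (j + 1), q j] ![e j, b j, a j]) ∧
    -- the new pseudocircle encloses `P`: the side that contains the closure of `P` contains
    -- no other vertices of `A` than those of `P`
    (∃ z ∈ (range (B.curve none))ᶜ,
      closure P ⊆ connectedComponentIn (range (B.curve none))ᶜ z ∧
      A.vertices ∩ connectedComponentIn (range (B.curve none))ᶜ z = range p) ∧
    -- it intersects only the pseudocircles that bound `P`
    (∀ i, (range (A.curve i) ∩ range (B.curve none)).Nonempty → ∃ j, (e j).idx = i) ∧
    -- it intersects them in the ten points with parameters `x j`, `y j` only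
    (∀ s, B.curve none s ∈ A.support → s ∈ range x ∪ range y) ∧
    (∀ j, B.curve none (x j) ∈ (a j).openCarrier) ∧
    (∀ j, B.curve none (y j) ∈ (b j).openCarrier) ∧
    -- it traverses `T j` from `x j` to `y j`, then a face that is not a triangle from `y j`
    -- to `x (j + 1)`
    (∀ j, B.curve none '' openArc (x j) (y j) ⊆ T j) ∧
    (∀ j, ∃ F, A.IsFace F ∧ ¬ A.IsPolygonalFace 3 F ∧
      B.curve none '' openArc (y j) (x (j + 1)) ⊆ F)

end PseudocircleArrangement

/-! Four colours suffice by Brooks' theorem. In a simple arrangement exactly two passages of curves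
go through each vertex, so the arrangement graph has maximum degree at most 4, and only a clique of
size 5 could obstruct a 4-colouring. Such a clique is closed under adjacency. In `A` it would
therefore contain all or none of the vertices of each triangular face. Saturation makes every vertex
count for exactly two triangles, so the 5 vertices of the clique would give 10 incidences, which is
not a multiple of 3. In `B` a clique that avoids the new curve is already a clique of `A`, and one
that meets it would have to contain all ten crossings.

Three colours fail by parity. Fix a 3-colouring of `B` and a colour `i`, and let `P_i`, `Q_i`,
`X_i`, `Y_i` be the numbers of indices `j` for which `p j`, `q j`, the crossing at `x j`, the
crossing at `y j` have colour `i`. The triangles of `A` other than the `T j` survive in `B`; each of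
these `N` triangles has exactly one vertex of colour `i`. Counting incidences of all triangles of
`A` with colour `i` gives `N + 2 P_i + Q_i = 2 M_i`, where `M_i` is the number of vertices of `A` of
that colour. The new curve creates the 3-cycles `x j, y j, q j` and `p (j + 1), y j, x (j + 1)`,
whence `X_i + Y_i + Q_i = 5 = P_i + Y_i + X_i` and `P_i = Q_i`. So all three `P_i` have the parity
of `N`. But a colour class on the 5-cycle bounding the pentagon has at most two elements, so the
`P_i` are 2, 2, 1 in some order, a contradiction.

The counting is carried by `exists_sum_boundarySum`, the bounds by `colorable_four` and
`not_colorable_three`. -/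

/-- `c` is a proper colouring of the subgraph of `G` induced on `S`. -/
def SimpleGraph.ProperOn {V C : Type*} (G : SimpleGraph V) (c : V → C) (S : Finset V) : Prop :=
  ∀ u ∈ S, ∀ w ∈ S, G.Adj u w → c u ≠ c w

/-! ### Brooks' theorem -/

namespace SimpleGraph

section Brooks

open scoped Classical

variable {V : Type*} {G : SimpleGraph V} {k : ℕ}

theorem ProperOn.mono {C : Type*} {c : V → C} {S T : Finset V} (h : G.ProperOn c T)
    (hST : S ⊆ T) : G.ProperOn c S :=
  fun u hu w hw => h u (hST hu) w (hST hw)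

theorem ProperOn.update {C : Type*} {c : V → C} {S : Finset V} (h : G.ProperOn c S) {v : V}
    (hv : v ∉ S) {x : C} (hx : ∀ w ∈ S, G.Adj v w → c w ≠ x) :
    G.ProperOn (Function.update c v x) (insert v S) := by
  intro u hu w hw huw
  rcases Finset.mem_insert.1 hu with rfl | hu'
  · have hwu : w ≠ u := huw.ne'
    have hwS : w ∈ S := (Finset.mem_insert.1 hw).resolve_left hwu
    rw [Function.update_self, Function.update_of_ne hwu]
    exact (hx w hwS huw).symm
  · have huv : u ≠ v := fun h => hv (h ▸ hu')
    rcases Finset.mem_insert.1 hw with rfl | hw'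
    · rw [Function.update_self, Function.update_of_ne huv]
      exact hx u hu' huw.symm
    · have hwv : w ≠ v := fun h => hv (h ▸ hw')
      rw [Function.update_of_ne huv, Function.update_of_ne hwv]
      exact h u hu' w hw' huw

theorem exists_color_notMem {s : Finset (Fin k)} (hs : s.card < k) : ∃ x, x ∉ s := by
  by_contra! h
  have : s = Finset.univ := Finset.eq_univ_iff_forall.2 h
  simp [this] at hs

/-- A colouring extends to a vertex that sees fewer than `k` colours. -/
theorem ProperOn.exists_insert {c : V → Fin k} {S : Finset V} (h : G.ProperOn c S) {v : V}
    (hv : v ∉ S) (hx : ((S.filter (G.Adj v)).image c).card < k) :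
    ∃ c' : V → Fin k, G.ProperOn c' (insert v S) ∧ ∀ u ∈ S, c' u = c u := by
  obtain ⟨x, hx⟩ := exists_color_notMem hx
  refine ⟨Function.update c v x, h.update hv ?_, fun u hu => ?_⟩
  · rintro w hw hvw rfl
    exact hx (Finset.mem_image_of_mem _ (Finset.mem_filter.2 ⟨hw, hvw⟩))
  · exact Function.update_of_ne (fun h : u = v => hv (h ▸ hu)) _ _

/-- The finite sets that arise from `{r}` by successively adding neighbours. -/
inductive GrownFrom (G : SimpleGraph V) (r : V) : Finset V → Prop
  | singleton : GrownFrom G r {r}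
  | extend (u w : V) (U : Finset V) : GrownFrom G r U → u ∉ U → w ∈ U → G.Adj u w →
      GrownFrom G r (insert u U)

theorem GrownFrom.root_mem {r : V} {U : Finset V} (h : G.GrownFrom r U) : r ∈ U := by
  induction h with
  | singleton => simp
  | extend u w U _ _ _ _ ih => exact Finset.mem_insert_of_mem ih

/-- A vertex either reaches all of `S` inside `S`, or `S` splits into two nonempty parts without
edges between them. -/
theorem exists_grownFrom_or_split {r : V} {S : Finset V} (hr : r ∈ S) :
    ∃ W ⊆ S, G.GrownFrom r W ∧ ∀ u ∈ S \ W, ∀ w ∈ W, ¬ G.Adj u w := by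
  let 𝒲 := S.powerset.filter (G.GrownFrom r)
  have hne : 𝒲.Nonempty := ⟨{r}, by simp [𝒲, hr, GrownFrom.singleton]⟩
  obtain ⟨W, hW, hmax⟩ := 𝒲.exists_max_image Finset.card hne
  rw [Finset.mem_filter, Finset.mem_powerset] at hW
  refine ⟨W, hW.1, hW.2, fun u hu w hw huw => ?_⟩
  rw [Finset.mem_sdiff] at hu
  have := hmax (insert u W) (by
    rw [Finset.mem_filter, Finset.mem_powerset]
    exact ⟨Finset.insert_subset hu.1 hW.1, GrownFrom.extend u w W hW.2 hu.2 hw huw⟩)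
  rw [Finset.card_insert_of_notMem hu.2] at this
  omega

theorem exists_perm_apply_apply {C : Type*} {x y x' y' : C} (h : x = y ↔ x' = y') :
    ∃ σ : Equiv.Perm C, σ x = x' ∧ σ y = y' := by
  by_cases hxy : x = y
  · exact ⟨Equiv.swap x x', by simp, by rw [← hxy, ← h.1 hxy]; simp⟩
  · have hxy' : x' ≠ y' := fun h' => hxy (h.2 h')
    refine ⟨(Equiv.swap x x').trans (Equiv.swap (Equiv.swap x x' y) y'), ?_, by simp⟩
    simp only [Equiv.trans_apply, Equiv.swap_apply_left]
    refine Equiv.swap_apply_of_ne_of_ne (fun h' => hxy ?_) hxy'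
    apply (Equiv.swap x x').injective
    rw [Equiv.swap_apply_left, ← h']

/-- Two colourings of parts without edges between them, overlapping in `a` and `b`, can be glued
if they agree on whether `a` and `b` have the same colour. -/
theorem exists_properOn_glue {W R : Finset V} {a b : V} {c₁ c₂ : V → Fin k}
    (h₁ : G.ProperOn c₁ (insert a (insert b W))) (h₂ : G.ProperOn c₂ (insert a (insert b R)))
    (ha : a ∉ R) (hb : b ∉ R) (hWR : Disjoint R W)
    (hadj : ∀ u ∈ R, ∀ w ∈ W, ¬ G.Adj u w) (h : c₂ a = c₂ b ↔ c₁ a = c₁ b) :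
    ∃ c : V → Fin k, G.ProperOn c (insert a (insert b (W ∪ R))) := by
  obtain ⟨σ, hσa, hσb⟩ := exists_perm_apply_apply h
  let c : V → Fin k := fun u => if u ∈ R then σ (c₂ u) else c₁ u
  have hc1 : ∀ u ∈ insert a (insert b W), c u = c₁ u := by
    intro u hu
    refine if_neg fun huR => ?_
    simp only [Finset.mem_insert] at hu
    rcases hu with rfl | rfl | hu
    · exact ha huR
    · exact hb huR
    · exact Finset.disjoint_left.1 hWR huR hu
  have hc2 : ∀ u ∈ insert a (insert b R), c u = σ (c₂ u) := by
    intro u hu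
    simp only [Finset.mem_insert] at hu
    rcases hu with rfl | rfl | hu
    · rw [hσa]; exact if_neg ha
    · rw [hσb]; exact if_neg hb
    · exact if_pos hu
  refine ⟨c, fun u hu w hw huw => ?_⟩
  by_cases h1 : u ∈ insert a (insert b W) ∧ w ∈ insert a (insert b W)
  · rw [hc1 u h1.1, hc1 w h1.2]
    exact h₁ u h1.1 w h1.2 huw
  by_cases h2 : u ∈ insert a (insert b R) ∧ w ∈ insert a (insert b R)
  · rw [hc2 u h2.1, hc2 w h2.2]
    exact fun h' => h₂ u h2.1 w h2.2 huw (σ.injective h')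
  -- An edge contained in neither part has one end in `W` and the other in `R`.
  exfalso
  have h3 := hadj u
  have h4 := hadj w
  have huw' := huw.symm
  simp only [Finset.mem_insert, Finset.mem_union] at hu hw h1 h2
  grind

/-- Besides the colours of its neighbours in `W`, the vertex `a` has to avoid only the colour of
`b`; one colour is still free. -/
theorem exists_properOn_ne {W : Finset V} {a b : V} (hab : a ≠ b) (ha : a ∉ W)
    (hc : ∃ c : V → Fin k, G.ProperOn c (insert b W)) (hnadj : ¬ G.Adj a b)
    (hd : (W.filter (G.Adj a)).card + 1 < k) :
    ∃ c : V → Fin k, G.ProperOn c (insert a (insert b W)) ∧ c a ≠ c b := by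
  obtain ⟨c, hc⟩ := hc
  obtain ⟨x, hx⟩ := exists_color_notMem (k := k)
    (s := insert (c b) ((W.filter (G.Adj a)).image c)) (by
      refine lt_of_le_of_lt (Finset.card_insert_le _ _) (lt_of_le_of_lt ?_ hd)
      exact Nat.succ_le_succ Finset.card_image_le)
  rw [Finset.mem_insert, not_or] at hx
  refine ⟨Function.update c a x, hc.update (by simp [hab, ha]) ?_, ?_⟩
  · rintro w hw haw rfl
    rcases Finset.mem_insert.1 hw with rfl | hw
    · exact hnadj haw
    · exact hx.2 (Finset.mem_image_of_mem _ (by simp [hw, haw]))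
  · rw [Function.update_self, Function.update_of_ne hab.symm]
    exact hx.1

/-- Together `a` and `b` see fewer than `k` colours on `W`, so some colour is free for both. -/
theorem exists_properOn_eq {W : Finset V} {a b : V} (hab : a ≠ b) (ha : a ∉ W) (hb : b ∉ W)
    (hc : ∃ c : V → Fin k, G.ProperOn c W) (hnadj : ¬ G.Adj a b)
    (hd : (W.filter (G.Adj a)).card + (W.filter (G.Adj b)).card < k) :
    ∃ c : V → Fin k, G.ProperOn c (insert a (insert b W)) ∧ c a = c b := by
  obtain ⟨c, hc⟩ := hc
  obtain ⟨x, hx⟩ := exists_color_notMem (k := k)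
    (s := (W.filter (G.Adj a)).image c ∪ (W.filter (G.Adj b)).image c) (by
      refine lt_of_le_of_lt (Finset.card_union_le _ _) (lt_of_le_of_lt ?_ hd)
      exact Nat.add_le_add Finset.card_image_le Finset.card_image_le)
  rw [Finset.mem_union, not_or] at hx
  have h1 : G.ProperOn (Function.update c b x) (insert b W) := by
    refine hc.update hb ?_
    rintro w hw hbw rfl
    exact hx.2 (Finset.mem_image_of_mem _ (by simp [hw, hbw]))
  refine ⟨Function.update (Function.update c b x) a x, h1.update (by simp [hab, ha]) ?_, ?_⟩
  · intro w hw haw hwx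
    rcases Finset.mem_insert.1 hw with rfl | hw
    · exact hnadj haw
    · rw [Function.update_of_ne (fun h : w = b => hb (h ▸ hw))] at hwx
      subst hwx
      exact hx.1 (Finset.mem_image_of_mem _ (by simp [hw, haw]))
  · rw [Function.update_self, Function.update_of_ne hab.symm, Function.update_self]

variable [Fintype V]

theorem card_filter_adj_le (hdeg : ∀ v, (Finset.univ.filter (G.Adj v)).card ≤ k) (v : V)
    (S : Finset V) : (S.filter (G.Adj v)).card ≤ k :=
  (Finset.card_le_card (Finset.filter_subset_filter _ (Finset.subset_univ S))).trans (hdeg v)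

theorem card_filter_adj_add_le (hdeg : ∀ v, (Finset.univ.filter (G.Adj v)).card ≤ k) (v : V)
    {S T : Finset V} (hST : Disjoint S T) :
    (S.filter (G.Adj v)).card + (T.filter (G.Adj v)).card ≤ k := by
  rw [← Finset.card_union_of_disjoint (Finset.disjoint_filter_filter hST),
    ← Finset.filter_union]
  exact card_filter_adj_le hdeg v _

/-- Greedy colouring towards a root that has two neighbours of the same colour. -/
theorem GrownFrom.exists_properOn (hdeg : ∀ v, (Finset.univ.filter (G.Adj v)).card ≤ k)
    {r a b : V} {U : Finset V} (hU : G.GrownFrom r U) :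
    ∀ (S : Finset V) (c : V → Fin k), Disjoint S U → G.ProperOn c S → a ∈ S → b ∈ S → a ≠ b →
      G.Adj r a → G.Adj r b → c a = c b → ∃ c' : V → Fin k, G.ProperOn c' (S ∪ U) := by
  induction hU with
  | singleton =>
    intro S c hd hc ha hb hab hra hrb hcab
    have hr : r ∉ S := by simpa using hd
    obtain ⟨c', hc', -⟩ := hc.exists_insert hr <| by
      -- Dropping `a` from the neighbours of the root loses no colour, because `b` has the same one;
      -- at most `k - 1` colours are seen.
      have h1 : (S.filter (G.Adj r)).image c ⊆ ((S.filter (G.Adj r)).erase a).image c := by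
        intro x hx
        obtain ⟨w, hw, rfl⟩ := Finset.mem_image.1 hx
        by_cases hwa : w = a
        · subst hwa
          rw [hcab]
          exact Finset.mem_image_of_mem _ (by simp [hab.symm, hb, hrb])
        · exact Finset.mem_image_of_mem _ (Finset.mem_erase.2 ⟨hwa, hw⟩)
      have h2 : a ∈ S.filter (G.Adj r) := by simp [ha, hra]
      calc _ ≤ _ := Finset.card_le_card h1
        _ ≤ _ := Finset.card_image_le
        _ < _ := Finset.card_erase_lt_of_mem h2
        _ ≤ k := card_filter_adj_le hdeg r S
    exact ⟨c', by rwa [Finset.union_comm, ← Finset.insert_eq]⟩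
  | extend u w U hU hu hw huw ih =>
    intro S c hd hc ha hb hab hra hrb hcab
    rw [Finset.disjoint_insert_right] at hd
    -- The vertex that was added last is coloured first: its neighbour `w` is still uncoloured, so
    -- at most `k - 1` neighbours block a colour.
    obtain ⟨c', hc', hcc⟩ := hc.exists_insert hd.1 <| by
      have h1 := card_filter_adj_add_le hdeg u hd.2
      have h2 : 0 < (U.filter (G.Adj u)).card := Finset.card_pos.2 ⟨w, by simp [hw, huw]⟩
      have h3 : ((S.filter (G.Adj u)).image c).card ≤ _ := Finset.card_image_le
      omega
    have hd' : Disjoint (insert u S) U := Finset.disjoint_insert_left.2 ⟨hu, hd.2⟩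
    obtain ⟨d, hd⟩ := ih (insert u S) c' hd' hc' (by simp [ha]) (by simp [hb]) hab hra hrb
      (by rw [hcc a ha, hcc b hb, hcab])
    refine ⟨d, ?_⟩
    rwa [Finset.insert_union, ← Finset.union_insert] at hd

/-- Induction on `S`. A vertex `v` with `k` neighbours in `S` has two nonadjacent ones `a`, `b`. If
removing them leaves `S` connected, `a` and `b` get the same colour and the rest is coloured
greedily towards `v`. Otherwise `{a, b}` separates `S`, and colourings of the two sides are glued.
-/
theorem exists_properOn_of_cliqueFree (hk : 3 ≤ k)
    (hdeg : ∀ v, (Finset.univ.filter (G.Adj v)).card ≤ k) (hG : G.CliqueFree (k + 1))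
    (S : Finset V) : ∃ c : V → Fin k, G.ProperOn c S := by
  induction S using Finset.strongInduction with
  | H S IH =>
  rcases S.eq_empty_or_nonempty with rfl | ⟨v, hv⟩
  · exact ⟨fun _ => ⟨0, by omega⟩, by simp [ProperOn]⟩
  by_cases hlow : ((S.erase v).filter (G.Adj v)).card < k
  · obtain ⟨c, hc⟩ := IH _ (Finset.erase_ssubset hv)
    obtain ⟨c', hc', -⟩ := hc.exists_insert (Finset.notMem_erase v S)
      (Finset.card_image_le.trans_lt hlow)
    exact ⟨c', by rwa [Finset.insert_erase hv] at hc'⟩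
  have hN : ((S.erase v).filter (G.Adj v)).card = k :=
    le_antisymm (card_filter_adj_le hdeg v _) (not_lt.1 hlow)
  obtain ⟨a, ha, b, hb, hab, hnadj⟩ : ∃ a ∈ (S.erase v).filter (G.Adj v),
      ∃ b ∈ (S.erase v).filter (G.Adj v), a ≠ b ∧ ¬ G.Adj a b := by
    by_contra! hcl
    refine hG (insert v ((S.erase v).filter (G.Adj v))) ⟨?_, ?_⟩
    · rw [Finset.coe_insert, isClique_insert]
      exact ⟨fun x hx y hy hxy => hcl x hx y hy hxy, fun x hx _ => (Finset.mem_filter.1 hx).2⟩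
    · rw [Finset.card_insert_of_notMem (by simp), hN]
  rw [Finset.mem_filter, Finset.mem_erase] at ha hb
  obtain ⟨⟨hav, haS⟩, hva⟩ := ha
  obtain ⟨⟨hbv, hbS⟩, hvb⟩ := hb
  let S' := (S.erase a).erase b
  have hvS' : v ∈ S' := by simp [S', hav.symm, hbv.symm, hv]
  have hS : insert a (insert b S') = S := by
    rw [Finset.insert_erase (Finset.mem_erase.2 ⟨hab.symm, hbS⟩), Finset.insert_erase haS]
  have haS' : a ∉ S' := by simp [S']
  have hbS' : b ∉ S' := by simp [S']
  obtain ⟨W, hWS, hW, hsep⟩ := exists_grownFrom_or_split (G := G) hvS'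
  have haW : a ∉ W := fun h => haS' (hWS h)
  have hbW : b ∉ W := fun h => hbS' (hWS h)
  by_cases hWeq : W = S'
  · have hcol : G.ProperOn (fun _ => (⟨0, by omega⟩ : Fin k)) {a, b} := by
      intro u hu w hw huw
      simp only [Finset.mem_insert, Finset.mem_singleton] at hu hw
      rcases hu with rfl | rfl <;> rcases hw with rfl | rfl
      · exact absurd rfl huw.ne
      · exact absurd huw hnadj
      · exact absurd huw.symm hnadj
      · exact absurd rfl huw.ne
    obtain ⟨c, hc⟩ := hW.exists_properOn hdeg {a, b} _
      (by simp [haW, hbW]) hcol (by simp) (by simp) hab hva hvb rfl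
    refine ⟨c, ?_⟩
    rw [Finset.insert_union, ← Finset.insert_eq, hWeq, hS] at hc
    exact hc
  set R := S' \ W with hR
  have haR : a ∉ R := fun h => haS' (Finset.sdiff_subset h)
  have hbR : b ∉ R := fun h => hbS' (Finset.sdiff_subset h)
  have hRne : R.Nonempty := by
    rw [hR, Finset.sdiff_nonempty]
    exact fun h => hWeq (hWS.antisymm h)
  have hWne : W.Nonempty := ⟨v, hW.root_mem⟩
  have hWR : Disjoint R W := Finset.sdiff_disjoint
  have hunion : W ∪ R = S' := Finset.union_sdiff_of_subset hWS
  have hcol : ∀ Y Z : Finset V, Z.Nonempty → Disjoint Y Z → Y ∪ Z = S' →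
      ∃ c : V → Fin k, G.ProperOn c (insert a (insert b Y)) := by
    intro Y Z hZ hYZ hU
    apply IH
    obtain ⟨z, hz⟩ := hZ
    rw [Finset.ssubset_iff_of_subset]
    · have hzS' : z ∈ S' := hU ▸ Finset.mem_union_right _ hz
      refine ⟨z, by rw [← hS]; simp [hzS'], ?_⟩
      simp only [Finset.mem_insert, not_or]
      exact ⟨fun h => haS' (h ▸ hzS'), fun h => hbS' (h ▸ hzS'),
        Finset.disjoint_right.1 hYZ hz⟩
    · rw [← hS, ← hU]
      exact Finset.insert_subset_insert _ (Finset.insert_subset_insert _ Finset.subset_union_left)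
  have hcW := hcol W R hRne hWR.symm hunion
  have hcR := hcol R W hWne hWR (by rw [Finset.union_comm, hunion])
  -- If `a` or `b` has at most `k - 2` neighbours in `Y`, it can be recoloured to differ from the
  -- other. If not, both have at least `k - 1` neighbours in `Y`, hence at most one each in `Z`, and
  -- `2 < k` leaves a common colour there.
  have key : ∀ Y Z : Finset V, Disjoint Y Z → a ∉ Y → b ∉ Y → a ∉ Z → b ∉ Z →
      (∃ c : V → Fin k, G.ProperOn c (insert a (insert b Y))) →
      (∃ c : V → Fin k, G.ProperOn c (insert a (insert b Z))) →
      (∃ c : V → Fin k, G.ProperOn c (insert a (insert b Y)) ∧ c a ≠ c b) ∨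
      (∃ c : V → Fin k, G.ProperOn c (insert a (insert b Z)) ∧ c a = c b) := by
    intro Y Z hYZ haY hbY haZ hbZ ⟨c₁, hc₁⟩ ⟨c₂, hc₂⟩
    by_cases h1 : (Y.filter (G.Adj a)).card + 1 < k
    · exact Or.inl (exists_properOn_ne hab haY
        ⟨c₁, hc₁.mono (Finset.subset_insert _ _)⟩ hnadj h1)
    by_cases h2 : (Y.filter (G.Adj b)).card + 1 < k
    · obtain ⟨c, hc, hne⟩ := exists_properOn_ne hab.symm hbY
        ⟨c₁, hc₁.mono (by rw [Finset.insert_comm]; exact Finset.subset_insert _ _)⟩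
        (fun h => hnadj h.symm) h2
      exact Or.inl ⟨c, by rwa [Finset.insert_comm], hne.symm⟩
    · have h3 := card_filter_adj_add_le hdeg a hYZ
      have h4 := card_filter_adj_add_le hdeg b hYZ
      exact Or.inr (exists_properOn_eq hab haZ hbZ ⟨c₂, hc₂.mono
        ((Finset.subset_insert _ _).trans (Finset.subset_insert _ _))⟩ hnadj (by omega))
  -- `key` in both directions either settles both sides consistently or gives both behaviours on one
  -- side, which can then be adapted to any colouring of the other.
  have hmatch : ∃ c₁ c₂ : V → Fin k, G.ProperOn c₁ (insert a (insert b W)) ∧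
      G.ProperOn c₂ (insert a (insert b R)) ∧ (c₂ a = c₂ b ↔ c₁ a = c₁ b) := by
    rcases key W R hWR.symm haW hbW haR hbR hcW hcR with ⟨c₁, h₁, e₁⟩ | ⟨c₂, h₂, e₂⟩ <;>
    rcases key R W hWR haR hbR haW hbW hcR hcW with ⟨d₂, g₂, f₂⟩ | ⟨d₁, g₁, f₁⟩
    · exact ⟨c₁, d₂, h₁, g₂, by simp [e₁, f₂]⟩
    · obtain ⟨c, hc⟩ := hcR
      by_cases h : c a = c b
      · exact ⟨d₁, c, g₁, hc, by simp [h, f₁]⟩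
      · exact ⟨c₁, c, h₁, hc, by simp [h, e₁]⟩
    · obtain ⟨c, hc⟩ := hcW
      by_cases h : c a = c b
      · exact ⟨c, c₂, hc, h₂, by simp [h, e₂]⟩
      · exact ⟨c, d₂, hc, g₂, by simp [h, f₂]⟩
    · exact ⟨d₁, c₂, g₁, h₂, by simp [f₁, e₂]⟩
  obtain ⟨c₁, c₂, h₁, h₂, h⟩ := hmatch
  obtain ⟨c, hc⟩ := exists_properOn_glue h₁ h₂ haR hbR hWR hsep h
  exact ⟨c, by rwa [hunion, hS] at hc⟩

/-- **Brooks' theorem**: a finite graph of maximum degree at most `k ≥ 3` without a clique of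
size `k + 1` is `k`-colourable. -/
theorem colorable_of_cliqueFree_succ (hk : 3 ≤ k)
    (hdeg : ∀ v, (Finset.univ.filter (G.Adj v)).card ≤ k) (hG : G.CliqueFree (k + 1)) :
    G.Colorable k := by
  obtain ⟨c, hc⟩ := exists_properOn_of_cliqueFree hk hdeg hG Finset.univ
  exact ⟨Coloring.mk c fun {u w} h => hc u (Finset.mem_univ _) w (Finset.mem_univ _) h⟩

end Brooks

end SimpleGraph

/-! ### Arcs on the circle -/

section Arc

/-- The degenerate case has to be excluded: `openArc s s` is the punctured circle, while `sbtw s x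
s` never holds. -/
theorem sbtw_of_mem_openArc {s t x : UnitAddCircle} (hst : s ≠ t) (h : x ∈ openArc s t) :
    sbtw s x t := by
  obtain ⟨h1, h2, h3⟩ := h
  refine sbtw_of_btw_not_btw h1 fun h' => ?_
  rcases h1.antisymm h' with h | h | h
  · exact h2 h.symm
  · exact h3 h
  · exact hst h.symm

theorem mem_openArc_of_sbtw {s t x : UnitAddCircle} (h : sbtw s x t) : x ∈ openArc s t := by
  refine ⟨h.btw, ?_, ?_⟩
  · rintro rfl
    exact sbtw_irrefl_left h
  · rintro rfl
    exact sbtw_irrefl_right h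

theorem openArc_subset_left {s t m : UnitAddCircle} (hm : m ∈ openArc s t) :
    openArc s m ⊆ openArc s t := by
  intro x hx
  have hx' := sbtw_of_mem_openArc hm.2.1.symm hx
  by_cases hst : s = t
  · subst hst
    exact ⟨btw_rfl_left_right, hx.2.1, hx.2.1⟩
  · exact mem_openArc_of_sbtw (sbtw_trans_right hx' (sbtw_of_mem_openArc hst hm))

theorem openArc_subset_right {s t m : UnitAddCircle} (hm : m ∈ openArc s t) :
    openArc m t ⊆ openArc s t := by
  intro x hx
  have hx' := sbtw_of_mem_openArc hm.2.2 hx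
  by_cases hst : s = t
  · subst hst
    exact ⟨btw_rfl_left_right, hx.2.2, hx.2.2⟩
  · exact mem_openArc_of_sbtw ((sbtw_of_mem_openArc hst hm).trans_left hx')

theorem notMem_openArc_left (s t : UnitAddCircle) : s ∉ openArc s t := fun h => h.2.1 rfl

theorem notMem_openArc_right (s t : UnitAddCircle) : t ∉ openArc s t := fun h => h.2.2 rfl

theorem openArc_subset_closedArc (s t : UnitAddCircle) : openArc s t ⊆ closedArc s t :=
  fun _ h => h.1

/-- Two open arcs with a common point, each avoiding the starting point of the other, have the
same starting point. -/
theorem openArc_left_unique {s t s' t' x : UnitAddCircle} (hx : x ∈ openArc s t)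
    (hx' : x ∈ openArc s' t') (hs : s ∉ openArc s' t') (hs' : s' ∉ openArc s t) : s = s' := by
  by_contra hne
  rcases btw_total s s' x with h | h
  · exact hs' (openArc_subset_left hx ⟨h, Ne.symm hne, fun h => notMem_openArc_left _ _ (h ▸ hx')⟩)
  · exact hs (openArc_subset_left hx' ⟨h.cyclic_left, hne,
      fun h => notMem_openArc_left _ _ (h ▸ hx)⟩)

theorem openArc_right_unique {s t s' t' x : UnitAddCircle} (hx : x ∈ openArc s t)
    (hx' : x ∈ openArc s' t') (ht : t ∉ openArc s' t') (ht' : t' ∉ openArc s t) : t = t' := by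
  by_contra hne
  rcases btw_total x t' t with h | h
  · exact ht' (openArc_subset_right hx ⟨h, fun h => notMem_openArc_right _ _ (h ▸ hx'),
      Ne.symm hne⟩)
  · exact ht (openArc_subset_right hx' ⟨btw_cyclic_right h,
      fun h => notMem_openArc_right _ _ (h ▸ hx), hne⟩)

/-- Of two different endpoints, the one reached first from `s` would lie inside the other arc. -/
theorem openArc_right_eq {s t t' : UnitAddCircle} (ht : t ∉ openArc s t')
    (ht' : t' ∉ openArc s t) (hs : t = s → t' = s) (hs' : t' = s → t = s) : t = t' := by
  by_contra hne
  have h1 : t ≠ s := fun h => hne (h.trans (hs h).symm)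
  have h2 : t' ≠ s := fun h => hne ((hs' h).trans h.symm)
  rcases btw_total s t t' with h | h
  · exact ht ⟨h, h1, hne⟩
  · exact ht' ⟨btw_cyclic_right h, h2, Ne.symm hne⟩

theorem openArc_left_eq {s s' t : UnitAddCircle} (hs : s ∉ openArc s' t)
    (hs' : s' ∉ openArc s t) (ht : s = t → s' = t) (ht' : s' = t → s = t) : s = s' := by
  by_contra hne
  have h1 : s ≠ t := fun h => hne (h.trans (ht h).symm)
  have h2 : s' ≠ t := fun h => hne ((ht' h).trans h.symm)
  rcases btw_total s s' t with h | h
  · exact hs' ⟨h, Ne.symm hne, h2⟩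
  · exact hs ⟨h.cyclic_left, hne, h1⟩

theorem mem_openArc_self {s x : UnitAddCircle} (h : x ≠ s) : x ∈ openArc s s :=
  ⟨btw_rfl_left_right, h, h⟩

theorem openArc_nonempty (s t : UnitAddCircle) : (openArc s t).Nonempty := by
  obtain ⟨a, rfl⟩ := QuotientAddGroup.mk_surjective s
  -- The half-open interval excludes `a` and includes `a + 1`, so that for `s = t` the midpoint is
  -- still interior to the arc.
  obtain ⟨b, hb, rfl⟩ : ∃ b ∈ Ioc a (a + 1), (b : UnitAddCircle) = t := by
    refine ⟨AddCircle.equivIoc 1 a t, (AddCircle.equivIoc 1 a t).2, ?_⟩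
    exact (AddCircle.equivIoc 1 a).symm_apply_apply t
  have hab : (a + b) / 2 ∈ Ioo a b := ⟨by linarith [hb.1], by linarith [hb.1]⟩
  have hm : toIcoMod (zero_lt_one' ℝ) a ((a + b) / 2) = (a + b) / 2 :=
    (toIcoMod_eq_self _).2 ⟨hab.1.le, by linarith [hab.2, hb.2]⟩
  have ha : toIcoMod (zero_lt_one' ℝ) a a = a := toIcoMod_apply_left _ _
  have hb' : toIocMod (zero_lt_one' ℝ) a b = b := (toIocMod_eq_self _).2 hb
  refine ⟨(((a + b) / 2 : ℝ) : UnitAddCircle), ?_, ?_, ?_⟩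
  · refine QuotientAddGroup.btw_coe_iff.2 ?_
    rw [hm, hb']
    exact hab.2.le
  · intro h
    have := (AddCircle.coe_eq_coe_iff_of_mem_Ico (p := (1 : ℝ)) (a := a)
      ⟨hab.1.le, by linarith [hab.2, hb.2]⟩ ⟨le_rfl, by linarith⟩).1 h
    linarith [hab.1]
  · intro h
    have := (QuotientAddGroup.eq_iff_sub_mem.1 h)
    obtain ⟨n, hn⟩ := AddSubgroup.mem_zmultiples_iff.1 this
    simp only [zsmul_eq_mul, mul_one] at hn
    have h1 : (-1 : ℝ) < n := by rw [hn]; linarith [hab.1, hb.1, hb.2]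
    have h2 : (n : ℝ) < 0 := by rw [hn]; linarith [hab.2]
    have h1' : (-1 : ℤ) < n := by exact_mod_cast h1
    have h2' : n < (0 : ℤ) := by exact_mod_cast h2
    omega

/-- Every point of a finite set of points on the circle has a successor in the set. -/
theorem exists_openArc_disjoint {S : Set UnitAddCircle} (hS : S.Finite) {s : UnitAddCircle}
    (hs : s ∈ S) : ∃ t ∈ S, ∀ x ∈ openArc s t, x ∉ S := by
  -- The choice `t = s` is allowed and is forced when `S = {s}`. A point of `S` inside a minimal arc
  -- would cut off an arc with fewer points.
  obtain ⟨t, ht, hmin⟩ := hS.exists_minimalFor (fun t => (openArc s t ∩ S).ncard) S ⟨s, hs⟩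
  refine ⟨t, ht, fun m hm hmS => ?_⟩
  have hlt : (openArc s m ∩ S).ncard < (openArc s t ∩ S).ncard := by
    refine ncard_lt_ncard ?_ (hS.subset inter_subset_right)
    refine ⟨inter_subset_inter_left _ (openArc_subset_left hm), fun h => ?_⟩
    exact notMem_openArc_right _ _ (h ⟨hm, hmS⟩).1
  exact (hmin hmS hlt.le).not_gt hlt

end Arc

/-! ### Flags, edges and degrees -/

namespace PseudocircleArrangement

section Edges

variable {X : Type*} [TopologicalSpace X] {ι : Type*} {A : PseudocircleArrangement X ι}

theorem vertices_finite [Finite ι] (A : PseudocircleArrangement X ι) : A.vertices.Finite := by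
  have h : A.vertices ⊆ ⋃ p : {p : ι × ι // p.1 ≠ p.2},
      range (A.curve p.1.1) ∩ range (A.curve p.1.2) := by
    rintro x ⟨i, j, hij, hx⟩
    exact mem_iUnion.2 ⟨⟨(i, j), hij⟩, hx⟩
  refine (finite_iUnion fun p => ?_).subset h
  exact finite_of_encard_le_coe (k := 2) (A.inter_le_two _ _ p.2)

/-- The passages of the pseudocircles through the vertices. -/
@[ext]
structure Flag (A : PseudocircleArrangement X ι) where
  idx : ι
  param : UnitAddCircle
  mem : A.curve idx param ∈ A.vertices

/-- The vertex of a flag. -/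
def Flag.vertex (d : A.Flag) : A.vertices := ⟨A.curve d.idx d.param, d.mem⟩

theorem Flag.ext_vertex {d d' : A.Flag} (h : d.idx = d'.idx) (hv : d.vertex = d'.vertex) :
    d = d' := by
  obtain ⟨i, s, hs⟩ := d
  obtain ⟨j, t, ht⟩ := d'
  obtain rfl : i = j := h
  exact Flag.ext rfl (A.injective_curve i (congrArg Subtype.val hv))

instance [Finite ι] : Finite A.Flag := by
  have := A.vertices_finite.to_subtype
  refine Finite.of_injective (fun d : A.Flag => (d.idx, d.vertex)) fun d d' h => ?_
  exact Flag.ext_vertex (Prod.ext_iff.1 h).1 (Prod.ext_iff.1 h).2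

/-- Two curves pass through a vertex by definition, a third is excluded by simplicity, and
injectivity allows each curve only one passage. -/
theorem IsSimple.card_flag_vertex (hs : A.IsSimple) [Fintype A.Flag] [DecidableEq A.vertices]
    (v : A.vertices) : (Finset.univ.filter fun d : A.Flag => d.vertex = v).card = 2 := by
  classical
  obtain ⟨i, j, hij, ⟨s, hsv⟩, ⟨t, htv⟩⟩ := v.2
  let d₁ : A.Flag := ⟨i, s, hsv ▸ v.2⟩
  let d₂ : A.Flag := ⟨j, t, htv ▸ v.2⟩
  have h₁ : d₁.vertex = v := Subtype.ext hsv
  have h₂ : d₂.vertex = v := Subtype.ext htv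
  refine Finset.card_eq_two.2 ⟨d₁, d₂, fun h => hij (congrArg Flag.idx h), ?_⟩
  ext d
  rw [Finset.mem_filter, Finset.mem_insert, Finset.mem_singleton]
  constructor
  · rintro ⟨-, h⟩
    by_cases hki : d.idx = i
    · exact Or.inl (Flag.ext_vertex hki (h.trans h₁.symm))
    by_cases hkj : d.idx = j
    · exact Or.inr (Flag.ext_vertex hkj (h.trans h₂.symm))
    · have : v.1 ∈ range (A.curve i) ∩ range (A.curve j) ∩ range (A.curve d.idx) :=
        ⟨⟨⟨s, hsv⟩, ⟨t, htv⟩⟩, ⟨d.param, congrArg Subtype.val h⟩⟩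
      rw [hs i j d.idx hij (Ne.symm hkj) (Ne.symm hki)] at this
      exact this.elim
  · rintro (rfl | rfl)
    exacts [⟨Finset.mem_univ _, h₁⟩, ⟨Finset.mem_univ _, h₂⟩]

/-- The flag at the beginning of an edge. -/
def Edge.srcFlag (e : A.Edge) : A.Flag := ⟨e.idx, e.src, e.src_mem⟩

/-- The flag at the end of an edge. -/
def Edge.tgtFlag (e : A.Edge) : A.Flag := ⟨e.idx, e.tgt, e.tgt_mem⟩

theorem Edge.srcFlag_injective : Function.Injective (Edge.srcFlag (A := A)) := by
  rintro ⟨i, s, t, hs, ht, h⟩ ⟨j, s', t', hs', ht', h'⟩ hee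
  have h1 : i = j := congrArg Flag.idx hee
  have h2 : s = s' := congrArg Flag.param hee
  subst h1 h2
  have h3 : t = t' := by
    refine openArc_right_eq (s := s) (fun hm => h' t hm ht) (fun hm => h t' hm ht') ?_ ?_
    · rintro rfl
      by_contra hne
      exact h t' (mem_openArc_self hne) ht'
    · rintro rfl
      by_contra hne
      exact h' t (mem_openArc_self hne) ht
  subst h3
  rfl

theorem Edge.tgtFlag_injective : Function.Injective (Edge.tgtFlag (A := A)) := by
  rintro ⟨i, s, t, hs, ht, h⟩ ⟨j, s', t', hs', ht', h'⟩ hee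
  have h1 : i = j := congrArg Flag.idx hee
  have h2 : t = t' := congrArg Flag.param hee
  subst h1 h2
  have h3 : s = s' := by
    refine openArc_left_eq (t := t) (fun hm => h' s hm hs) (fun hm => h s' hm hs') ?_ ?_
    · rintro rfl
      by_contra hne
      exact h s' (mem_openArc_self hne) hs'
    · rintro rfl
      by_contra hne
      exact h' s (mem_openArc_self hne) hs
  subst h3
  rfl

theorem Edge.srcFlag_bijective [Finite ι] : Function.Bijective (Edge.srcFlag (A := A)) := by
  refine ⟨Edge.srcFlag_injective, ?_⟩
  rintro ⟨i, s, hs⟩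
  have hfin : {u | A.curve i u ∈ A.vertices}.Finite :=
    A.vertices_finite.preimage (A.injective_curve i).injOn
  obtain ⟨t, ht, h⟩ := exists_openArc_disjoint hfin hs
  exact ⟨⟨i, s, t, hs, ht, h⟩, rfl⟩

instance [Finite ι] : Finite A.Edge := Finite.of_injective _ Edge.srcFlag_injective

/-- Surjectivity comes from counting: edges and flags are equinumerous via `srcFlag`. -/
theorem Edge.tgtFlag_bijective [Finite ι] : Function.Bijective (Edge.tgtFlag (A := A)) :=
  Edge.tgtFlag_injective.bijective_of_nat_card_le (Nat.card_eq_of_bijective _ srcFlag_bijective).ge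

theorem IsSimple.sum_flag [Finite ι] (hs : A.IsSimple) [Fintype A.Flag] [Fintype A.vertices]
    (g : A.vertices → ℕ) : ∑ d : A.Flag, g d.vertex = 2 * ∑ v, g v := by
  classical
  rw [← Finset.sum_fiberwise Finset.univ Flag.vertex, Finset.mul_sum]
  refine Finset.sum_congr rfl fun v _ => ?_
  rw [Finset.sum_congr rfl (g := fun _ => g v) fun d hd => by rw [(Finset.mem_filter.1 hd).2],
    Finset.sum_const, hs.card_flag_vertex, smul_eq_mul]

/-- Each vertex carries two flags, and each flag starts exactly one edge. -/
theorem IsSimple.sum_src [Finite ι] (hs : A.IsSimple) [Fintype A.Edge] [Fintype A.vertices]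
    (g : A.vertices → ℕ) : ∑ e : A.Edge, g e.srcFlag.vertex = 2 * ∑ v, g v := by
  have := Fintype.ofFinite A.Flag
  rw [← hs.sum_flag]
  exact Edge.srcFlag_bijective.sum_comp fun d => g d.vertex

theorem IsSimple.sum_tgt [Finite ι] (hs : A.IsSimple) [Fintype A.Edge] [Fintype A.vertices]
    (g : A.vertices → ℕ) : ∑ e : A.Edge, g e.tgtFlag.vertex = 2 * ∑ v, g v := by
  have := Fintype.ofFinite A.Flag
  rw [← hs.sum_flag]
  exact Edge.tgtFlag_bijective.sum_comp fun d => g d.vertex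

open scoped Classical in
theorem IsSimple.card_filter_adj_le [Finite ι] (hs : A.IsSimple) [Fintype A.vertices]
    (v : A.vertices) : (Finset.univ.filter (A.graph.Adj v)).card ≤ 4 := by
  have := Fintype.ofFinite A.Edge
  -- Indicator weights turn the two sums into counts: two edges start at `v` and two end there.
  have h1 := hs.sum_src fun w => if w = v then 1 else 0
  have h2 := hs.sum_tgt fun w => if w = v then 1 else 0
  simp only [Finset.sum_ite_eq', Finset.mem_univ, if_true, Finset.sum_boole, Nat.cast_id] at h1 h2
  have hsub : Finset.univ.filter (A.graph.Adj v) ⊆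
      (Finset.univ.filter fun e : A.Edge => e.srcFlag.vertex = v).image (·.tgtFlag.vertex) ∪
      (Finset.univ.filter fun e : A.Edge => e.tgtFlag.vertex = v).image (·.srcFlag.vertex) := by
    intro w hw
    obtain ⟨-, e, he⟩ := (Finset.mem_filter.1 hw).2
    rw [Finset.mem_union, Finset.mem_image, Finset.mem_image]
    rcases he with ⟨h, h'⟩ | ⟨h, h'⟩
    · exact Or.inl ⟨e, by simpa using Subtype.ext h, Subtype.ext h'⟩
    · exact Or.inr ⟨e, by simpa using Subtype.ext h', Subtype.ext h⟩
  have h3 := Finset.card_le_card hsub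
  have h4 := Finset.card_union_le
    ((Finset.univ.filter fun e : A.Edge => e.srcFlag.vertex = v).image (·.tgtFlag.vertex))
    ((Finset.univ.filter fun e : A.Edge => e.tgtFlag.vertex = v).image (·.srcFlag.vertex))
  have h5 := Finset.card_image_le
    (s := Finset.univ.filter fun e : A.Edge => e.srcFlag.vertex = v) (f := (·.tgtFlag.vertex))
  have h6 := Finset.card_image_le
    (s := Finset.univ.filter fun e : A.Edge => e.tgtFlag.vertex = v) (f := (·.srcFlag.vertex))
  omega

/-! ### Double counting over triangular faces -/

theorem Edge.Joins.symm {e : A.Edge} {u v : X} (h : e.Joins u v) : e.Joins v u := Or.symm h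

theorem Edge.Joins.left_mem {e : A.Edge} {u v : X} (h : e.Joins u v) : u ∈ A.vertices := by
  rcases h with ⟨rfl, -⟩ | ⟨-, rfl⟩
  exacts [e.src_mem, e.tgt_mem]

theorem Edge.Joins.right_mem {e : A.Edge} {u v : X} (h : e.Joins u v) : v ∈ A.vertices :=
  h.symm.left_mem

theorem Edge.openCarrier_nonempty (e : A.Edge) : e.openCarrier.Nonempty :=
  (openArc_nonempty _ _).image _

theorem Edge.notMem_vertices_of_mem_openCarrier {e : A.Edge} {z : X} (h : z ∈ e.openCarrier) :
    z ∉ A.vertices := by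
  obtain ⟨x, hx, rfl⟩ := h
  exact e.interior_notMem x hx

theorem Edge.openCarrier_subset_closedCarrier (e : A.Edge) : e.openCarrier ⊆ e.closedCarrier :=
  image_mono (openArc_subset_closedArc _ _)

/-- An interior point of an edge lies on no other edge. -/
theorem Edge.eq_of_mem {e f : A.Edge} {z : X} (he : z ∈ e.openCarrier)
    (hf : z ∈ f.closedCarrier) : e = f := by
  obtain ⟨x, hx, rfl⟩ := he
  obtain ⟨y, hy, hxy⟩ := hf
  have hidx : f.idx = e.idx := by
    by_contra hne
    exact e.interior_notMem x hx ⟨f.idx, e.idx, hne, ⟨y, hxy⟩, ⟨x, rfl⟩⟩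
  have hv := e.interior_notMem x hx
  rw [← hxy] at hv
  have hy' : y ∈ openArc f.src f.tgt :=
    ⟨hy, fun h => hv (h ▸ f.src_mem), fun h => hv (h ▸ f.tgt_mem)⟩
  obtain ⟨i, s, t, hs, ht, h⟩ := e
  obtain ⟨j, s', t', hs', ht', h'⟩ := f
  obtain rfl : j = i := hidx
  obtain rfl : y = x := A.injective_curve j hxy
  obtain rfl : s = s' := openArc_left_unique hx hy' (fun hm => h' s hm hs) fun hm => h s' hm hs'
  obtain rfl : t = t' := openArc_right_unique hx hy' (fun hm => h' t hm ht) fun hm => h t' hm ht'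
  rfl

/-- A single interior point determines its edge, which turns incidence with the face into membership
in the list `e`. -/
theorem IsFaceWithBoundary.openCarrier_subset_iff {F : Set X} {k : ℕ} [NeZero k] {v : Fin k → X}
    {e : Fin k → A.Edge} (h : A.IsFaceWithBoundary F v e) {f : A.Edge} :
    f.openCarrier ⊆ frontier F ↔ f ∈ range e := by
  rw [h.frontier_eq]
  constructor
  · intro hf
    obtain ⟨z, hz⟩ := f.openCarrier_nonempty
    obtain ⟨j, hj⟩ := mem_iUnion.1 (hf hz)
    exact ⟨j, (Edge.eq_of_mem hz hj).symm⟩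
  · rintro ⟨j, rfl⟩
    exact (e j).openCarrier_subset_closedCarrier.trans
      (subset_iUnion (fun j => (e j).closedCarrier) j)

theorem Edge.Joins.sum_eq {e : A.Edge} {u v : X} (h : e.Joins u v) (g : X → ℕ) :
    g e.srcFlag.vertex + g e.tgtFlag.vertex = g u + g v := by
  rcases h with ⟨rfl, rfl⟩ | ⟨rfl, rfl⟩
  · rfl
  · exact add_comm _ _

open scoped Classical in
/-- The sum of the values of `g` at the ends of the edges on the boundary of a face. -/
noncomputable def boundarySum (A : PseudocircleArrangement X ι) [Fintype A.Edge] (g : X → ℕ)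
    (F : Set X) : ℕ :=
  ∑ e : A.Edge with e.openCarrier ⊆ frontier F, (g e.srcFlag.vertex + g e.tgtFlag.vertex)

/-- Every vertex of the boundary cycle is an end of two of its edges. -/
theorem IsFaceWithBoundary.boundarySum_eq [Fintype A.Edge] {F : Set X} {k : ℕ} [NeZero k]
    {v : Fin k → X} {e : Fin k → A.Edge} (h : A.IsFaceWithBoundary F v e) (g : X → ℕ) :
    A.boundarySum g F = 2 * ∑ j, g (v j) := by
  classical
  have h1 : (Finset.univ.filter fun f : A.Edge => f.openCarrier ⊆ frontier F) =
      Finset.univ.image e := by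
    ext f
    simp [h.openCarrier_subset_iff]
  rw [boundarySum, h1, Finset.sum_image h.injective_edge.injOn,
    Finset.sum_congr rfl fun j _ => (h.joins j).sum_eq g, Finset.sum_add_distrib, two_mul]
  congr 1
  exact Equiv.sum_comp (Equiv.addRight (1 : Fin k)) fun j => g (v j)

/-- In a triangle-saturated arrangement, summation over the triangles and their vertices counts
every vertex twice. -/
theorem IsTriangleSaturated.exists_sum_boundarySum [Finite ι] (hsat : A.IsTriangleSaturated)
    (hs : A.IsSimple) [Fintype A.Edge] [Fintype A.vertices] :
    ∃ 𝒯 : Finset (Set X), (∀ F, F ∈ 𝒯 ↔ A.IsPolygonalFace 3 F) ∧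
      ∀ g : X → ℕ, ∑ F ∈ 𝒯, A.boundarySum g F = 4 * ∑ v : A.vertices, g v := by
  classical
  choose τ hτ huniq using hsat
  refine ⟨Finset.univ.image τ, fun F => ?_, fun g => ?_⟩
  · rw [Finset.mem_image]
    constructor
    · rintro ⟨e, -, rfl⟩
      exact (hτ e).1
    · rintro ⟨v, e, h⟩
      exact ⟨e 0, Finset.mem_univ _,
        (huniq _ _ ⟨⟨v, e, h⟩, h.openCarrier_subset_iff.2 ⟨0, rfl⟩⟩).symm⟩
  · have h4 : 4 * ∑ v : A.vertices, g v =
        ∑ e : A.Edge, (g e.srcFlag.vertex + g e.tgtFlag.vertex) := by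
      rw [Finset.sum_add_distrib, hs.sum_src fun v => g v, hs.sum_tgt fun v => g v]
      ring
    -- Grouping the edges by their unique triangle `τ e`: the fibre over a triangle is the set of
    -- its boundary edges.
    rw [h4, ← Finset.sum_fiberwise_of_maps_to
      (fun e _ => Finset.mem_image_of_mem τ (Finset.mem_univ e))]
    refine Finset.sum_congr rfl fun F hF => Finset.sum_congr ?_ fun _ _ => rfl
    obtain ⟨e₀, -, rfl⟩ := Finset.mem_image.1 hF
    ext f
    simp only [Finset.mem_filter, Finset.mem_univ, true_and]
    constructor
    · intro h
      exact (huniq f _ ⟨(hτ e₀).1, h⟩).symm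
    · intro h
      rw [← h]
      exact (hτ f).2

open scoped Classical in
/-- In the graph of a simple arrangement a clique of size five is closed under adjacency. -/
theorem IsSimple.mem_of_adj_of_isNClique [Finite ι] (hs : A.IsSimple) {s : Finset A.vertices}
    (hcl : A.graph.IsNClique 5 s) {u w : A.vertices} (hu : u ∈ s) (huw : A.graph.Adj u w) :
    w ∈ s := by
  have := A.vertices_finite.fintype
  have hsub : s.erase u ⊆ Finset.univ.filter (A.graph.Adj u) := fun x hx => by
    rw [Finset.mem_erase] at hx
    simpa using hcl.1 hu hx.2 (Ne.symm hx.1)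
  have hcard : (s.erase u).card = 4 := by rw [Finset.card_erase_of_mem hu, hcl.2]
  have heq := Finset.eq_of_subset_of_card_le hsub
    ((hs.card_filter_adj_le u).trans hcard.ge)
  have : w ∈ s.erase u := by rw [heq]; simpa using huw
  exact Finset.mem_of_mem_erase this

/-- A divisibility argument takes the place of the nonplanarity of the complete graph on five
vertices: the clique is a union of components, so every triangle lies inside or outside it. -/
theorem IsTriangleSaturated.cliqueFree [Finite ι] (hsat : A.IsTriangleSaturated)
    (hs : A.IsSimple) : A.graph.CliqueFree 5 := by
  classical
  intro s hcl
  have := Fintype.ofFinite A.Edge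
  have := A.vertices_finite.fintype
  obtain ⟨𝒯, h𝒯, hsum⟩ := hsat.exists_sum_boundarySum hs
  let g : X → ℕ := fun z => if ∃ h : z ∈ A.vertices, ⟨z, h⟩ ∈ s then 1 else 0
  have hg : ∀ v : A.vertices, g v = if v ∈ s then 1 else 0 := fun v => by simp [g]
  have h1 : ∑ v : A.vertices, g v = 5 := by
    rw [Finset.sum_congr rfl fun v _ => hg v]
    simp [hcl.2]
  have h2 : ∀ F ∈ 𝒯, 6 ∣ A.boundarySum g F := by
    intro F hF
    obtain ⟨v, e, h⟩ := (h𝒯 F).1 hF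
    have hstep : ∀ j, g (v j) = g (v (j + 1)) := by
      intro j
      have hne : v j ≠ v (j + 1) := fun h' => by
        have := h.injective_vertex h'
        simp at this
      have hadj : A.graph.Adj ⟨v j, (h.joins j).left_mem⟩ ⟨v (j + 1), (h.joins j).right_mem⟩ :=
        ⟨fun h' => hne (congrArg Subtype.val h'), e j, h.joins j⟩
      have : (⟨v j, (h.joins j).left_mem⟩ : A.vertices) ∈ s ↔
          (⟨v (j + 1), (h.joins j).right_mem⟩ : A.vertices) ∈ s :=
        ⟨fun hm => hs.mem_of_adj_of_isNClique hcl hm hadj,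
          fun hm => hs.mem_of_adj_of_isNClique hcl hm hadj.symm⟩
      rw [hg ⟨v j, (h.joins j).left_mem⟩, hg ⟨v (j + 1), (h.joins j).right_mem⟩]
      simp only [this]
    have h12 : g (v 1) = g (v 2) := hstep 1
    have h01 : g (v 0) = g (v 1) := hstep 0
    rw [h.boundarySum_eq, Fin.sum_univ_three, ← h12, ← h01]
    exact ⟨g (v 0), by ring⟩
  -- The total is `4 * 5 = 20`, which 6 does not divide.
  have h3 := Finset.dvd_sum h2
  rw [hsum, h1] at h3
  omega

end Edges

end PseudocircleArrangement

/-! ### Edges after adding a pseudocircle -/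

namespace PseudocircleArrangement

section Corona

variable {X : Type*} [TopologicalSpace X] {ι : Type*} {A : PseudocircleArrangement X ι}
  {B : PseudocircleArrangement X (Option ι)}

theorem Edge.closedCarrier_subset_support (e : A.Edge) : e.closedCarrier ⊆ A.support := by
  rintro _ ⟨x, -, rfl⟩
  exact mem_iUnion.2 ⟨e.idx, x, rfl⟩

theorem IsFaceWithBoundary.disjoint_support {F : Set X} {k : ℕ} [NeZero k] {v : Fin k → X}
    {e : Fin k → A.Edge} (h : A.IsFaceWithBoundary F v e) : F ⊆ A.supportᶜ := by
  obtain ⟨x, -, rfl⟩ := h.isFace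
  exact connectedComponentIn_subset _ _

section Extension

variable (hAB : ∀ i, B.curve (some i) = A.curve i)

include hAB

theorem vertices_subset_of_curve_some : A.vertices ⊆ B.vertices := by
  rintro z ⟨i, j, hij, hi, hj⟩
  exact ⟨some i, some j, by simpa using hij, by rwa [hAB], by rwa [hAB]⟩

theorem mem_vertices_of_mem_support {s : UnitAddCircle} (hs : B.curve none s ∈ A.support) :
    B.curve none s ∈ B.vertices := by
  obtain ⟨i, hi⟩ := mem_iUnion.1 hs
  exact ⟨none, some i, by simp, ⟨s, rfl⟩, by rwa [hAB]⟩

theorem mem_support_of_mem_vertices {s : UnitAddCircle} (hs : B.curve none s ∈ B.vertices) :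
    B.curve none s ∈ A.support := by
  obtain ⟨i, j, hij, hi, hj⟩ := hs
  cases i with
  | some i => exact mem_iUnion.2 ⟨i, by rwa [hAB] at hi⟩
  | none =>
    cases j with
    | none => exact absurd rfl hij
    | some j => exact mem_iUnion.2 ⟨j, by rwa [hAB] at hj⟩

theorem mem_vertices_or_mem_range {z : X} (hz : z ∈ B.vertices) :
    z ∈ A.vertices ∨ z ∈ range (B.curve none) := by
  obtain ⟨i, j, hij, hi, hj⟩ := hz
  cases i with
  | none => exact Or.inr hi
  | some i =>
    cases j with
    | none => exact Or.inr hj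
    | some j =>
      rw [hAB] at hi hj
      exact Or.inl ⟨i, j, by simpa using hij, hi, hj⟩

theorem isSimple_of_curve_some (hs : A.IsSimple)
    (hd : ∀ s, B.curve none s ∉ A.vertices) : B.IsSimple := by
  have key : ∀ i j : ι, i ≠ j →
      range (B.curve (some i)) ∩ range (B.curve (some j)) ∩ range (B.curve none) = ∅ := by
    rintro i j hij
    rw [eq_empty_iff_forall_notMem]
    rintro z ⟨⟨h1, h2⟩, ⟨s, rfl⟩⟩
    rw [hAB] at h1 h2
    exact hd s ⟨i, j, hij, h1, h2⟩
  rintro (_ | i) (_ | j) (_ | k) hij hjk hik <;> try contradiction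
  · rw [inter_comm, ← inter_assoc, inter_comm (range (B.curve (some k)))]
    rw [inter_right_comm, inter_comm (range (B.curve none)), inter_right_comm]
    exact key j k (by simpa using hjk)
  · rw [inter_right_comm]
    exact key i k (by simpa using hik)
  · exact key i j (by simpa using hij)
  · simp only [hAB]
    exact hs i j k (by simpa using hij) (by simpa using hjk) (by simpa using hik)

theorem exists_joins_of_openArc {i : ι} {s t : UnitAddCircle} (hs : A.curve i s ∈ B.vertices)
    (ht : A.curve i t ∈ B.vertices) (hA : ∀ x ∈ openArc s t, A.curve i x ∉ A.vertices)
    (hB : ∀ x ∈ openArc s t, A.curve i x ∉ range (B.curve none)) :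
    ∃ f : B.Edge, f.Joins (A.curve i s) (A.curve i t) := by
  refine ⟨⟨some i, s, t, by rwa [hAB], by rwa [hAB], fun x hx hx' => ?_⟩, ?_⟩
  · rw [hAB] at hx'
    exact (mem_vertices_or_mem_range hAB hx').elim (hA x hx) (hB x hx)
  · left
    simp [hAB]

/-- An edge that the new pseudocircle does not cross is an edge of the extension. -/
theorem Edge.Joins.exists_joins {f : A.Edge} {u v : X} (h : f.Joins u v)
    (hf : ∀ s, B.curve none s ∉ f.openCarrier) : ∃ f' : B.Edge, f'.Joins u v := by
  have hsub := vertices_subset_of_curve_some hAB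
  obtain ⟨f', hf'⟩ := exists_joins_of_openArc hAB (hsub f.src_mem) (hsub f.tgt_mem)
    f.interior_notMem (fun x hx ⟨s, hs⟩ => hf s ⟨x, hx, hs.symm⟩)
  rcases h with ⟨rfl, rfl⟩ | ⟨rfl, rfl⟩
  exacts [⟨f', hf'⟩, ⟨f', hf'.symm⟩]

/-- An edge that the new pseudocircle crosses once is split into two edges of the extension. -/
theorem Edge.Joins.exists_joins_crossing {f : A.Edge} {u v : X} (h : f.Joins u v)
    {s : UnitAddCircle} (hs : B.curve none s ∈ f.openCarrier)
    (huniq : ∀ s', B.curve none s' ∈ f.openCarrier → s' = s) :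
    (∃ f' : B.Edge, f'.Joins u (B.curve none s)) ∧
      ∃ f' : B.Edge, f'.Joins v (B.curve none s) := by
  have hsub := vertices_subset_of_curve_some hAB
  obtain ⟨m, hm, hms⟩ := id hs
  have hmv : A.curve f.idx m ∈ B.vertices := by
    rw [hms]
    exact mem_vertices_of_mem_support hAB
      (f.closedCarrier_subset_support (f.openCarrier_subset_closedCarrier hs))
  have hne : ∀ x ∈ openArc f.src f.tgt, x ≠ m → A.curve f.idx x ∉ range (B.curve none) := by
    rintro x hx hxm ⟨s', hs'⟩
    have := huniq s' ⟨x, hx, hs'.symm⟩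
    subst this
    exact hxm (A.injective_curve _ (hs'.symm.trans hms.symm))
  obtain ⟨f₁, h₁⟩ := exists_joins_of_openArc hAB (hsub f.src_mem) hmv
    (fun x hx => f.interior_notMem x (openArc_subset_left hm hx))
    (fun x hx => hne x (openArc_subset_left hm hx) hx.2.2)
  obtain ⟨f₂, h₂⟩ := exists_joins_of_openArc hAB hmv (hsub f.tgt_mem)
    (fun x hx => f.interior_notMem x (openArc_subset_right hm hx))
    (fun x hx => hne x (openArc_subset_right hm hx) hx.2.1)
  rw [hms] at h₁ h₂
  rcases h with ⟨rfl, rfl⟩ | ⟨rfl, rfl⟩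
  exacts [⟨⟨f₁, h₁⟩, ⟨f₂, h₂.symm⟩⟩, ⟨⟨f₂, h₂.symm⟩, ⟨f₁, h₁⟩⟩]

/-- A piece of the new pseudocircle between two crossings that stays in the complement of the old
pseudocircles is an edge of the extension. -/
theorem exists_joins_none {s t : UnitAddCircle} (hs : B.curve none s ∈ A.support)
    (ht : B.curve none t ∈ A.support) (h : B.curve none '' openArc s t ⊆ A.supportᶜ) :
    ∃ f : B.Edge, f.Joins (B.curve none s) (B.curve none t) :=
  ⟨⟨none, s, t, mem_vertices_of_mem_support hAB hs, mem_vertices_of_mem_support hAB ht,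
    fun _ hx hx' => h (mem_image_of_mem _ hx) (mem_support_of_mem_vertices hAB hx')⟩,
    Or.inl ⟨rfl, rfl⟩⟩

/-- A clique that avoids the new pseudocircle is a clique of the old arrangement. -/
theorem exists_isNClique_of_disjoint {n : ℕ} {s : Finset B.vertices} (hs : B.graph.IsNClique n s)
    (hd : ∀ v ∈ s, v.1 ∉ range (B.curve none)) :
    ∃ s' : Finset A.vertices, A.graph.IsNClique n s' := by
  classical
  have hmem : ∀ v ∈ s, v.1 ∈ A.vertices := fun v hv =>
    (mem_vertices_or_mem_range hAB v.2).resolve_right (hd v hv)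
  let φ : {v // v ∈ s} → A.vertices := fun v => ⟨v.1.1, hmem v.1 v.2⟩
  have hφ : Function.Injective φ := fun v w h =>
    Subtype.ext (Subtype.ext (congrArg (fun z : A.vertices => z.1) h))
  refine ⟨s.attach.image φ, ?_, ?_⟩
  · intro u' hu' w' hw' huw
    obtain ⟨⟨u, hu⟩, -, rfl⟩ := Finset.mem_image.1 hu'
    obtain ⟨⟨w, hw⟩, -, rfl⟩ := Finset.mem_image.1 hw'
    refine ⟨huw, ?_⟩
    have hne : u ≠ w := fun h => huw (by subst h; rfl)
    -- An edge whose ends avoid the new curve lies on an old one, and its interior contains no old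
    -- vertices since these remain vertices of `B`.
    obtain ⟨-, ⟨i, s₀, t₀, hs₀, ht₀, hi⟩, he⟩ := hs.1 hu hw hne
    cases i with
    | none =>
      rcases he with ⟨h, -⟩ | ⟨-, h⟩
      · exact absurd ⟨_, h⟩ (hd u hu)
      · exact absurd ⟨_, h⟩ (hd u hu)
    | some i =>
      simp only [Edge.Joins, hAB] at he hi hs₀ ht₀
      have h1 : A.curve i s₀ ∈ A.vertices := by
        rcases he with ⟨h, -⟩ | ⟨h, -⟩ <;> rw [h]
        exacts [hmem u hu, hmem w hw]
      have h2 : A.curve i t₀ ∈ A.vertices := by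
        rcases he with ⟨-, h⟩ | ⟨-, h⟩ <;> rw [h]
        exacts [hmem w hw, hmem u hu]
      exact ⟨⟨i, s₀, t₀, h1, h2, fun x hx hx' =>
        hi x hx (vertices_subset_of_curve_some hAB hx')⟩, he⟩
  · rw [Finset.card_image_of_injective _ hφ, Finset.card_attach, hs.2]

end Extension

end Corona

end PseudocircleArrangement

/-! ### The corona and its crossings -/

namespace PseudocircleArrangement

variable {X : Type*} [TopologicalSpace X] {ι : Type*}

/-- The points, edges and faces that witness a corona extension. -/
structure IsCorona (A : PseudocircleArrangement X ι) (B : PseudocircleArrangement X (Option ι))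
    (P : Set X) (p q : Fin 5 → X) (e a b : Fin 5 → A.Edge) (T : Fin 5 → Set X)
    (x y : Fin 5 → UnitAddCircle) : Prop where
  curve_some : ∀ i, B.curve (some i) = A.curve i
  pentagon : A.IsFaceWithBoundary P p e
  triangle : ∀ j, A.IsFaceWithBoundary (T j) ![p j, p (j + 1), q j] ![e j, b j, a j]
  notMem_closure : ∀ s, B.curve none s ∉ closure P
  mem_range : ∀ s, B.curve none s ∈ A.support → s ∈ range x ∪ range y
  mem_a : ∀ j, B.curve none (x j) ∈ (a j).openCarrier
  mem_b : ∀ j, B.curve none (y j) ∈ (b j).openCarrier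
  inside : ∀ j, B.curve none '' openArc (x j) (y j) ⊆ A.supportᶜ
  outside : ∀ j, B.curve none '' openArc (y j) (x (j + 1)) ⊆ A.supportᶜ

theorem IsCoronaExtension.exists_isCorona {A : PseudocircleArrangement X ι}
    {B : PseudocircleArrangement X (Option ι)} {P : Set X} (h : A.IsCoronaExtension B P) :
    ∃ p q e a b T x y, IsCorona A B P p q e a b T x y := by
  obtain ⟨hAB, p, q, e, a, b, T, x, y, hP, hT, ⟨z, -, hz, -⟩, -, hs, ha, hb, hin, hout⟩ := h
  refine ⟨p, q, e, a, b, T, x, y, hAB, hP, hT, ?_, hs, ha, hb, ?_, ?_⟩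
  · exact fun s h => connectedComponentIn_subset _ _ (hz h) ⟨s, rfl⟩
  · exact fun j => (hin j).trans (hT j).disjoint_support
  · intro j
    obtain ⟨F, ⟨w, -, rfl⟩, -, hF⟩ := hout j
    exact hF.trans (connectedComponentIn_subset _ _)

namespace IsCorona

variable {A : PseudocircleArrangement X ι} {B : PseudocircleArrangement X (Option ι)}
  {P : Set X} {p q : Fin 5 → X} {e a b : Fin 5 → A.Edge} {T : Fin 5 → Set X}
  {x y : Fin 5 → UnitAddCircle}

theorem joins_e (h : IsCorona A B P p q e a b T x y) (j : Fin 5) : (e j).Joins (p j) (p (j + 1)) :=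
  h.pentagon.joins j

theorem joins_b (h : IsCorona A B P p q e a b T x y) (j : Fin 5) : (b j).Joins (p (j + 1)) (q j) :=
  (h.triangle j).joins 1

theorem joins_a (h : IsCorona A B P p q e a b T x y) (j : Fin 5) : (a j).Joins (p j) (q j) :=
  ((h.triangle j).joins 2).symm

/-- The new curve misses the closure of `P`. This keeps the pentagon edges intact in `B` and
separates them from the crossed edges `a j`, `b j`. -/
theorem notMem_range_of_mem (h : IsCorona A B P p q e a b T x y) {f : A.Edge} {s : UnitAddCircle}
    (hs : B.curve none s ∈ f.openCarrier) : f ∉ range e := fun hf =>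
  h.notMem_closure s (frontier_subset_closure (h.pentagon.openCarrier_subset_iff.2 hf hs))

theorem a_notMem (h : IsCorona A B P p q e a b T x y) (j : Fin 5) : a j ∉ range e :=
  h.notMem_range_of_mem (h.mem_a j)

theorem b_notMem (h : IsCorona A B P p q e a b T x y) (j : Fin 5) : b j ∉ range e :=
  h.notMem_range_of_mem (h.mem_b j)

theorem isPolygonalFace (h : IsCorona A B P p q e a b T x y) (j : Fin 5) :
    A.IsPolygonalFace 3 (T j) := ⟨_, _, h.triangle j⟩

theorem a_subset (h : IsCorona A B P p q e a b T x y) (j : Fin 5) :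
    (a j).openCarrier ⊆ frontier (T j) :=
  (h.triangle j).openCarrier_subset_iff.2 ⟨2, rfl⟩

theorem b_subset (h : IsCorona A B P p q e a b T x y) (j : Fin 5) :
    (b j).openCarrier ⊆ frontier (T j) :=
  (h.triangle j).openCarrier_subset_iff.2 ⟨1, rfl⟩

/-- If `T j = T k`, then `e k` is one of `e j`, `b j`, `a j`; the last two are crossed, hence not
edges of `P`. -/
theorem injective_T (h : IsCorona A B P p q e a b T x y) : Function.Injective T := by
  intro j k hjk
  have h1 : (e k).openCarrier ⊆ frontier (T k) :=
    (h.triangle k).openCarrier_subset_iff.2 ⟨0, rfl⟩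
  rw [← hjk, (h.triangle j).openCarrier_subset_iff] at h1
  obtain ⟨l, hl⟩ := h1
  fin_cases l
  · exact h.pentagon.injective_edge hl
  · exact absurd ⟨k, hl.symm⟩ (h.b_notMem j)
  · exact absurd ⟨k, hl.symm⟩ (h.a_notMem j)

/-- By saturation distinct triangles share no edge. Hence the ten edges `a j`, `b j` are distinct
and each is crossed exactly once. -/
theorem eq_of_subset (h : IsCorona A B P p q e a b T x y) (hsat : A.IsTriangleSaturated)
    {f : A.Edge} {j k : Fin 5} (hj : f.openCarrier ⊆ frontier (T j))
    (hk : f.openCarrier ⊆ frontier (T k)) : j = k :=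
  h.injective_T ((hsat f).unique ⟨h.isPolygonalFace j, hj⟩ ⟨h.isPolygonalFace k, hk⟩)

theorem injective_a (h : IsCorona A B P p q e a b T x y) (hsat : A.IsTriangleSaturated) :
    Function.Injective a := fun j k hjk =>
  h.eq_of_subset hsat (h.a_subset j) (hjk ▸ h.a_subset k)

theorem injective_b (h : IsCorona A B P p q e a b T x y) (hsat : A.IsTriangleSaturated) :
    Function.Injective b := fun j k hjk =>
  h.eq_of_subset hsat (h.b_subset j) (hjk ▸ h.b_subset k)

theorem a_ne_b (h : IsCorona A B P p q e a b T x y) (hsat : A.IsTriangleSaturated)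
    (j k : Fin 5) : a j ≠ b k := by
  intro hjk
  obtain rfl := h.eq_of_subset hsat (h.a_subset j) (hjk ▸ h.b_subset k)
  have := (h.triangle j).injective_edge (a₁ := 2) (a₂ := 1) hjk
  simp at this

theorem a_mem_support (h : IsCorona A B P p q e a b T x y) (j : Fin 5) :
    B.curve none (x j) ∈ A.support :=
  (a j).closedCarrier_subset_support ((a j).openCarrier_subset_closedCarrier (h.mem_a j))

theorem b_mem_support (h : IsCorona A B P p q e a b T x y) (j : Fin 5) :
    B.curve none (y j) ∈ A.support :=
  (b j).closedCarrier_subset_support ((b j).openCarrier_subset_closedCarrier (h.mem_b j))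

/-- The new pseudocircle crosses the edges `a j` and `b j` only, each once. -/
theorem crossing (h : IsCorona A B P p q e a b T x y) {f : A.Edge} {s : UnitAddCircle}
    (hs : B.curve none s ∈ f.openCarrier) :
    (∃ j, s = x j ∧ f = a j) ∨ ∃ j, s = y j ∧ f = b j := by
  have hc := f.openCarrier_subset_closedCarrier hs
  rcases h.mem_range s (f.closedCarrier_subset_support hc) with ⟨j, rfl⟩ | ⟨j, rfl⟩
  · exact Or.inl ⟨j, rfl, (Edge.eq_of_mem (h.mem_a j) hc).symm⟩
  · exact Or.inr ⟨j, rfl, (Edge.eq_of_mem (h.mem_b j) hc).symm⟩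

theorem notMem_vertices (h : IsCorona A B P p q e a b T x y) (s : UnitAddCircle) :
    B.curve none s ∉ A.vertices := by
  intro hs
  obtain ⟨i, -, -, hi, -⟩ := id hs
  rcases h.mem_range s (mem_iUnion.2 ⟨i, hi⟩) with ⟨j, rfl⟩ | ⟨j, rfl⟩
  · exact Edge.notMem_vertices_of_mem_openCarrier (h.mem_a j) hs
  · exact Edge.notMem_vertices_of_mem_openCarrier (h.mem_b j) hs

theorem isSimple (h : IsCorona A B P p q e a b T x y) (hs : A.IsSimple) : B.IsSimple :=
  isSimple_of_curve_some h.curve_some hs h.notMem_vertices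

theorem exists_joins_a (h : IsCorona A B P p q e a b T x y) (hsat : A.IsTriangleSaturated)
    (j : Fin 5) : (∃ f : B.Edge, f.Joins (p j) (B.curve none (x j))) ∧
      ∃ f : B.Edge, f.Joins (q j) (B.curve none (x j)) := by
  refine (h.joins_a j).exists_joins_crossing h.curve_some (h.mem_a j) fun s hs => ?_
  rcases h.crossing hs with ⟨k, rfl, hk⟩ | ⟨k, rfl, hk⟩
  · rw [h.injective_a hsat hk]
  · exact absurd hk (h.a_ne_b hsat j k)

theorem exists_joins_b (h : IsCorona A B P p q e a b T x y) (hsat : A.IsTriangleSaturated)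
    (j : Fin 5) : (∃ f : B.Edge, f.Joins (p (j + 1)) (B.curve none (y j))) ∧
      ∃ f : B.Edge, f.Joins (q j) (B.curve none (y j)) := by
  refine (h.joins_b j).exists_joins_crossing h.curve_some (h.mem_b j) fun s hs => ?_
  rcases h.crossing hs with ⟨k, rfl, hk⟩ | ⟨k, rfl, hk⟩
  · exact absurd hk.symm (h.a_ne_b hsat k j)
  · rw [h.injective_b hsat hk]

theorem exists_joins_e (h : IsCorona A B P p q e a b T x y) (j : Fin 5) :
    ∃ f : B.Edge, f.Joins (p j) (p (j + 1)) :=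
  (h.joins_e j).exists_joins h.curve_some fun _ hs => h.notMem_range_of_mem hs ⟨j, rfl⟩

theorem exists_joins_inside (h : IsCorona A B P p q e a b T x y) (j : Fin 5) :
    ∃ f : B.Edge, f.Joins (B.curve none (x j)) (B.curve none (y j)) :=
  exists_joins_none h.curve_some (h.a_mem_support j) (h.b_mem_support j) (h.inside j)

theorem exists_joins_outside (h : IsCorona A B P p q e a b T x y) (j : Fin 5) :
    ∃ f : B.Edge, f.Joins (B.curve none (y j)) (B.curve none (x (j + 1))) :=
  exists_joins_none h.curve_some (h.b_mem_support j) (h.a_mem_support (j + 1)) (h.outside j)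

theorem x_ne_y (h : IsCorona A B P p q e a b T x y) (hsat : A.IsTriangleSaturated) (j k : Fin 5) :
    B.curve none (x j) ≠ B.curve none (y k) := by
  intro heq
  have h1 := h.mem_a j
  rw [heq] at h1
  exact h.a_ne_b hsat j k
    (Edge.eq_of_mem h1 ((b k).openCarrier_subset_closedCarrier (h.mem_b k)))

theorem injective_x (h : IsCorona A B P p q e a b T x y) (hsat : A.IsTriangleSaturated) :
    Function.Injective fun j => B.curve none (x j) := by
  intro j k hjk
  have h1 := h.mem_a j
  rw [show B.curve none (x j) = _ from hjk] at h1
  exact h.injective_a hsat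
    (Edge.eq_of_mem h1 ((a k).openCarrier_subset_closedCarrier (h.mem_a k)))

theorem cliqueFree [Finite ι] (h : IsCorona A B P p q e a b T x y) (hs : A.IsSimple)
    (hsat : A.IsTriangleSaturated) : B.graph.CliqueFree 5 := by
  classical
  intro s hcl
  by_cases hd : ∀ v ∈ s, v.1 ∉ range (B.curve none)
  · obtain ⟨s', hs'⟩ := exists_isNClique_of_disjoint h.curve_some hcl hd
    exact hsat.cliqueFree hs s' hs'
  push Not at hd
  obtain ⟨v, hv, ⟨u, hu⟩⟩ := hd
  have hadj : ∀ {z w : B.vertices}, B.graph.Adj z w → (z ∈ s ↔ w ∈ s) := fun hzw =>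
    ⟨fun hm => (h.isSimple hs).mem_of_adj_of_isNClique hcl hm hzw,
      fun hm => (h.isSimple hs).mem_of_adj_of_isNClique hcl hm hzw.symm⟩
  let x' : Fin 5 → B.vertices := fun j =>
    ⟨B.curve none (x j), mem_vertices_of_mem_support h.curve_some (h.a_mem_support j)⟩
  let y' : Fin 5 → B.vertices := fun j =>
    ⟨B.curve none (y j), mem_vertices_of_mem_support h.curve_some (h.b_mem_support j)⟩
  have hxy : ∀ j k, x' j ≠ y' k := fun j k heq =>
    h.x_ne_y hsat j k (congrArg (fun z : B.vertices => z.1) heq)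
  -- The crossings form a closed walk along the new curve, so membership of one of them in `s`
  -- spreads to all.
  have h1 : ∀ j, x' j ∈ s ↔ y' j ∈ s := fun j => hadj ⟨hxy j j, h.exists_joins_inside j⟩
  have h2 : ∀ j, y' j ∈ s ↔ x' (j + 1) ∈ s := fun j =>
    hadj ⟨(hxy _ j).symm, h.exists_joins_outside j⟩
  have h3 : ∃ k, x' k ∈ s := by
    have hsup := mem_support_of_mem_vertices h.curve_some (s := u) (hu ▸ v.2)
    rcases h.mem_range u hsup with ⟨k, rfl⟩ | ⟨k, rfl⟩
    · exact ⟨k, by rwa [show x' k = v from Subtype.ext hu]⟩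
    · exact ⟨k, by rwa [h1, show y' k = v from Subtype.ext hu]⟩
  have h4 : ∀ j, x' j ∈ s := by
    have h5 : ∀ j, x' j ∈ s ↔ x' (j + 1) ∈ s := fun j => (h1 j).trans (h2 j)
    have e0 : x' 0 ∈ s ↔ x' 1 ∈ s := h5 0
    have e1 : x' 1 ∈ s ↔ x' 2 ∈ s := h5 1
    have e2 : x' 2 ∈ s ↔ x' 3 ∈ s := h5 2
    have e3 : x' 3 ∈ s ↔ x' 4 ∈ s := h5 3
    obtain ⟨k, hk⟩ := h3
    have h0 : x' 0 ∈ s := by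
      fin_cases k <;> simp only [Fin.zero_eta, Fin.mk_one, Fin.reduceFinMk] at hk <;> tauto
    intro j
    fin_cases j <;> simp only [Fin.zero_eta, Fin.mk_one, Fin.reduceFinMk] <;> tauto
  have h5 : Finset.univ.image x' = s := by
    refine Finset.eq_of_subset_of_card_le ?_ ?_
    · intro z hz
      obtain ⟨j, -, rfl⟩ := Finset.mem_image.1 hz
      exact h4 j
    · rw [hcl.2, Finset.card_image_of_injective _ fun j k hjk =>
        h.injective_x hsat (congrArg (fun z : B.vertices => z.1) hjk)]
      simp
  -- The five points `x' j` already exhaust the clique, so `y' 0` is one vertex too many.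
  have h6 := (h1 0).1 (h4 0)
  rw [← h5] at h6
  obtain ⟨j, -, hj⟩ := Finset.mem_image.1 h6
  exact hxy j 0 hj

theorem colorable_four [Finite ι] (h : IsCorona A B P p q e a b T x y) (hs : A.IsSimple)
    (hsat : A.IsTriangleSaturated) : B.graph.Colorable 4 := by
  classical
  have := B.vertices_finite.fintype
  exact SimpleGraph.colorable_of_cliqueFree_succ (by norm_num)
    (fun v => by convert (h.isSimple hs).card_filter_adj_le v) (h.cliqueFree hs hsat)

/-! ### The parity obstruction to three colours -/

theorem sum_indicator_eq_one {u v w : Fin 3} (huv : u ≠ v) (hvw : v ≠ w) (hwu : w ≠ u)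
    (i : Fin 3) : (if u = i then 1 else 0) + (if v = i then 1 else 0) +
      (if w = i then 1 else 0) = 1 := by
  revert u v w i
  decide

theorem sum_comp_add_one (f : Fin 5 → ℕ) : ∑ j, f (j + 1) = ∑ j, f j :=
  Equiv.sum_comp (Equiv.addRight (1 : Fin 5)) f

theorem sum_add_sum_add_sum_eq_five {f g h : Fin 5 → ℕ} (hfgh : ∀ j, f j + g j + h j = 1) :
    ∑ j, f j + ∑ j, g j + ∑ j, h j = 5 := by
  rw [← Finset.sum_add_distrib, ← Finset.sum_add_distrib, Finset.sum_congr rfl fun j _ => hfgh j]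
  simp

/-- The parity argument: in a proper colouring of the corona, the numbers of vertices `p j` of
the three colours do not all have the same parity. -/
theorem false_of_color_parity {p q x y : Fin 5 → Fin 3} (hpp : ∀ j, p j ≠ p (j + 1))
    (hpx : ∀ j, p j ≠ x j) (hqx : ∀ j, q j ≠ x j) (hpy : ∀ j, p (j + 1) ≠ y j)
    (hqy : ∀ j, q j ≠ y j) (hxy : ∀ j, x j ≠ y j) (hyx : ∀ j, y j ≠ x (j + 1)) (N : ℕ)
    (M : Fin 3 → ℕ)
    (hM : ∀ i, N + (2 * ∑ j, (if p j = i then 1 else 0) + ∑ j, (if q j = i then 1 else 0)) =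
      2 * M i) : False := by
  let g : (Fin 5 → Fin 3) → Fin 3 → ℕ := fun c i => ∑ j, if c j = i then 1 else 0
  have htotal : ∀ i, N + (2 * g p i + g q i) = 2 * M i := hM
  -- The 3-cycles `x j, y j, q j` at the tips of the `T j`.
  have hcap : ∀ i, g x i + g y i + g q i = 5 := fun i =>
    sum_add_sum_add_sum_eq_five fun j => sum_indicator_eq_one (hxy j) (hqy j).symm (hqx j) i
  -- The 3-cycles `p (j + 1), y j, x (j + 1)` at the corners of the pentagon.
  have hring : ∀ i, g p i + g y i + g x i = 5 := by
    intro i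
    have h1 := sum_add_sum_add_sum_eq_five fun j =>
      sum_indicator_eq_one (hpy j) (hyx j) (hpx (j + 1)).symm i
    rwa [sum_comp_add_one fun j => if p j = i then 1 else 0,
      sum_comp_add_one fun j => if x j = i then 1 else 0] at h1
  have hpent : ∀ i, 2 * g p i ≤ 5 := by
    intro i
    have h1 : ∑ j, ((if p j = i then 1 else 0) + (if p (j + 1) = i then 1 else 0)) ≤
        ∑ _j : Fin 5, 1 := by
      refine Finset.sum_le_sum fun j _ => ?_
      have := hpp j
      split_ifs with h1 h2
      · exact absurd (h1.trans h2.symm) this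
      all_goals simp
    rw [Finset.sum_add_distrib, sum_comp_add_one fun j => if p j = i then 1 else 0,
      ← two_mul] at h1
    exact h1
  have hall : g p 0 + g p 1 + g p 2 = 5 := by
    refine sum_add_sum_add_sum_eq_five fun j => ?_
    generalize p j = u
    revert u
    decide
  clear_value g
  have t0 := htotal 0
  have t1 := htotal 1
  have t2 := htotal 2
  have c0 := hcap 0
  have c1 := hcap 1
  have c2 := hcap 2
  have r0 := hring 0
  have r1 := hring 1
  have r2 := hring 2
  have b0 := hpent 0
  have b1 := hpent 1
  have b2 := hpent 2
  -- `hcap` and `hring` give `g p i = g q i`, so each `g p i` has the parity of `N`; but three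
  -- numbers at most 2 with sum 5 are 2, 2, 1.
  omega

theorem not_colorable_three [Finite ι] (h : IsCorona A B P p q e a b T x y) (hs : A.IsSimple)
    (hsat : A.IsTriangleSaturated) : ¬ B.graph.Colorable 3 := by
  classical
  rintro ⟨C⟩
  have := Fintype.ofFinite A.Edge
  have := A.vertices_finite.fintype
  -- The default 0 is harmless: colours are compared and counted only at vertices of `B`.
  let col : X → Fin 3 := fun z => if hz : z ∈ B.vertices then C ⟨z, hz⟩ else 0
  have hcol : ∀ {u v : X}, (∃ f : B.Edge, f.Joins u v) → u ≠ v → col u ≠ col v := by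
    rintro u v ⟨f, hf⟩ huv
    simp only [col, dif_pos hf.left_mem, dif_pos hf.right_mem]
    exact C.valid ⟨fun h' => huv (congrArg (fun z : B.vertices => z.1) h'), f, hf⟩
  have hne : ∀ {z : X} {s : UnitAddCircle}, z ∈ A.vertices → z ≠ B.curve none s := by
    rintro z s hz rfl
    exact h.notMem_vertices s hz
  let X' : Fin 5 → X := fun j => B.curve none (x j)
  let Y' : Fin 5 → X := fun j => B.curve none (y j)
  have hpp : ∀ j, col (p j) ≠ col (p (j + 1)) := fun j =>
    hcol (h.exists_joins_e j) fun h' => by simpa using h.pentagon.injective_vertex h'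
  have hpx : ∀ j, col (p j) ≠ col (X' j) := fun j =>
    hcol (h.exists_joins_a hsat j).1 (hne (h.joins_a j).left_mem)
  have hqx : ∀ j, col (q j) ≠ col (X' j) := fun j =>
    hcol (h.exists_joins_a hsat j).2 (hne (h.joins_a j).right_mem)
  have hpy : ∀ j, col (p (j + 1)) ≠ col (Y' j) := fun j =>
    hcol (h.exists_joins_b hsat j).1 (hne (h.joins_b j).left_mem)
  have hqy : ∀ j, col (q j) ≠ col (Y' j) := fun j =>
    hcol (h.exists_joins_b hsat j).2 (hne (h.joins_b j).right_mem)
  have hxy : ∀ j, col (X' j) ≠ col (Y' j) := fun j =>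
    hcol (h.exists_joins_inside j) (h.x_ne_y hsat j j)
  have hyx : ∀ j, col (Y' j) ≠ col (X' (j + 1)) := fun j =>
    hcol (h.exists_joins_outside j) (h.x_ne_y hsat (j + 1) j).symm
  obtain ⟨𝒯, h𝒯, hsum⟩ := hsat.exists_sum_boundarySum hs
  let g : Fin 3 → X → ℕ := fun i z => if col z = i then 1 else 0
  have hsub : Finset.univ.image T ⊆ 𝒯 := fun F hF => by
    obtain ⟨j, -, rfl⟩ := Finset.mem_image.1 hF
    exact (h𝒯 _).2 (h.isPolygonalFace j)
  have hother : ∀ i, ∀ F ∈ 𝒯 \ Finset.univ.image T, A.boundarySum (g i) F = 2 := by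
    intro i F hF
    rw [Finset.mem_sdiff, h𝒯] at hF
    obtain ⟨⟨v, f, hF⟩, hFT⟩ := hF
    have hstep : ∀ j, col (v j) ≠ col (v (j + 1)) := by
      intro j
      -- A crossed edge lies on some `T k`, and saturation would then give `F = T k`; so all edges
      -- of `F` survive in `B`.
      refine hcol ((hF.joins j).exists_joins h.curve_some fun s hs' => hFT ?_) fun h' => by
        simpa using hF.injective_vertex h'
      have hj : (f j).openCarrier ⊆ frontier F := hF.openCarrier_subset_iff.2 ⟨j, rfl⟩
      rw [Finset.mem_image]
      rcases h.crossing hs' with ⟨k, -, hk⟩ | ⟨k, -, hk⟩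
      · exact ⟨k, Finset.mem_univ _, (hsat (f j)).unique
          ⟨h.isPolygonalFace k, hk ▸ h.a_subset k⟩ ⟨⟨v, f, hF⟩, hj⟩⟩
      · exact ⟨k, Finset.mem_univ _, (hsat (f j)).unique
          ⟨h.isPolygonalFace k, hk ▸ h.b_subset k⟩ ⟨⟨v, f, hF⟩, hj⟩⟩
    have h1 : g i (v 0) + g i (v 1) + g i (v 2) = 1 :=
      sum_indicator_eq_one (hstep 0) (hstep 1) (hstep 2) i
    rw [hF.boundarySum_eq, Fin.sum_univ_three, h1]
  have hcorona : ∀ i j, A.boundarySum (g i) (T j) =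
      2 * (g i (p j) + g i (p (j + 1)) + g i (q j)) := by
    intro i j
    rw [(h.triangle j).boundarySum_eq, Fin.sum_univ_three]
    rfl
  refine false_of_color_parity hpp hpx hqx hpy hqy hxy hyx (𝒯 \ Finset.univ.image T).card
    (fun i => ∑ v : A.vertices, g i v) fun i => ?_
  -- The double count for colour `i`, still with the factor 2 that `boundarySum` carries.
  have h1 : 2 * (𝒯 \ Finset.univ.image T).card +
      2 * (2 * ∑ j, g i (p j) + ∑ j, g i (q j)) = 4 * ∑ v : A.vertices, g i v := by
    rw [← hsum (g i), ← Finset.sum_sdiff hsub, Finset.sum_congr rfl (hother i),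
      Finset.sum_image h.injective_T.injOn, Finset.sum_congr rfl fun j _ => hcorona i j,
      ← Finset.mul_sum, Finset.sum_add_distrib, Finset.sum_add_distrib,
      sum_comp_add_one fun j => g i (p j), Finset.sum_const, smul_eq_mul]
    ring
  change _ + (2 * ∑ j, g i (p j) + ∑ j, g i (q j)) = _
  omega

end IsCorona

end PseudocircleArrangement

theorem mainTheorem7 {X : Type*} [TopologicalSpace X] (hX : IsSphereOrPlane X)
    {ι : Type*} [Finite ι] (A : PseudocircleArrangement X ι)
    (hsimple : A.IsSimple) (hsat : A.IsTriangleSaturated)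
    (P : Set X) (hP : A.IsPolygonalFace 5 P)
    (B : PseudocircleArrangement X (Option ι)) (hB : A.IsCoronaExtension B P) :
    B.graph.chromaticNumber = 4 := by
  obtain ⟨p, q, e, a, b, T, x, y, h⟩ := hB.exists_isCorona
  exact SimpleGraph.chromaticNumber_eq_iff_colorable_not_colorable.2
    ⟨h.colorable_four hsimple hsat, h.not_colorable_three hsimple hsat⟩
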